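/- **Setting.** Let $n,m,p,T\in\mathbb N$, and let $\dot x_t=Ax_t+Bu_t$, $y_t=Cx_t$ with $A\in\mathbb R^{n\times n}$, $B\in\mathbb R^{n\times m}$, $C\in\mathbb R^{p\times n}$, $\operatorname{rank}C=p$. Let $Q\in\mathbb R^{p\times p}$ be symmetric positive semidefinite and $R\in\mathbb R^{m\times m}$ symmetric positive definite. Assume that $(A,B)$ is controllable and that $(A,C)$ and $(A,(C^\top QC)^{1/2})$ are observable. Let $L\in\mathbb R^{n\times p}$ be such that all eigenvalues of $M:=A-LC$ lie in the open left half-plane, and let $A_\epsilon\in\mathbb R^{n\times n}$ have the same characteristic polynomial $s^n+a_{n-1}s^{n-1}+\dots+a_0$ as $M$. *Filter.* Let $A_s$ be the companion matrix with ones on the superdiagonal and last row $(-a_0,\dots,-a_{n-1})$, $b_s=(0,\dots,0,1)^\top\in\mathbb R^n$, $\mathcal A_s=\operatorname{diag}(I_{m+p}\otimes A_s,A_\epsilon)$, $\mathcal B_s=\operatorname{diag}(I_{m+p}\otimes b_s,0_{n\times n})$, and let $\mathcal B_s^u$, $\mathcal B_s^y$ consist of the first $m$ and the next $p$ columns of $\mathcal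 B_s$. For a square matrix $N$ of size $n$ write $\operatorname{adj}(sI-N)=\sum_{k=0}^{n-1}D_k(N)s^k$, and for $v\in\mathbb R^n$ put $\mathcal K(N,v)=[D_0(N)v,\dots,D_{n-1}(N)v]\in\mathbb R^{n\times n}$. Choose $\eta^\epsilon_0\in\mathbb R^n$ with $\mathcal K(A_\epsilon,\eta_0^\epsilon)$ invertible. The substitute state $\eta_t\in\mathbb R^{(m+p+1)n}$ is generated by $\dot\eta_t=\mathcal A_s\eta_t+\mathcal B_s[u_t^\top,y_t^\top,0]^\top$, $\eta_0=[0,(\eta^\epsilon_0)^\top]^\top$. Put $$S=\big[\mathcal K(M,B_1),\dots,\mathcal K(M,B_m),\ \mathcal K(M,L_1),\dots,\mathcal K(M,L_p),\ \mathcal K(M,x_0)\,\mathcal K(A_\epsilon,\eta^\epsilon_0)^{-1}\big],$$ where $B_i$, $L_j$ are the columns of $B$, $L$. *Data.* The input is persistently exciting of order $2n$ on an open interval $\mathbb I\subseteq[0,\infty)$, i.e. $u$ is $2n-1$ times continuously differentiable on $\mathbb I$ and $\nu^\top[u_t^\top,\dots,(u_t^{(2n-1)})^\top]^\top=0$ for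 all $t\in\mathbb I$ only if $\nu=0$. For some $t\ge0$, $\Delta t>0$, the matrices $E_0,E_1,U_0,Y_0$ collect the values of $\eta,\dot\eta,u,y$ at the times $t,t+\Delta t,\dots,t+(T-1)\Delta t$. Let $F$ be an orthogonal matrix with $E_0=F\begin{bmatrix}\Phi_0\\0\end{bmatrix}$, where $\Phi_0$ has $(m+2)n$ rows and the zero block has $(p-1)n$ rows; let $F_1$ consist of the first $(m+2)n$ rows of $F^\top$, so that $\Phi_0=F_1E_0$, and put $\Phi_1=F_1E_1$. Assume that $\Phi_0$ has full row rank $(m+2)n$. *Transformed LQR problem.* Put $\mathcal A_F=F_1(\mathcal A_s+\mathcal B_s^yCS)F_1^\top$, $\mathcal B_F=F_1\mathcal B^u_s$, $Q_\phi=F_1S^\top C^\top QCSF_1^\top$. For $\phi_0\in\mathbb R^{(m+2)n}$ and a gain $K\in\mathbb R^{m\times(m+2)n}$ let $J(\phi_0,K)=\int_0^\infty(\phi_t^\top Q_\phi\phi_t+u_t^\top Ru_t)\,dt\in[0,\infty]$ along $\dot\phi_t=\mathcal A_F\phi_t+\mathcal B_Fu_t$, $u_t=-K\phi_t$. A gain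 is called stabilizing if all eigenvalues of $\mathcal A_F-\mathcal B_FK$ lie in the open left half-plane, and optimal if it minimizes $J(\phi_0,\cdot)$ over all gains, for every $\phi_0$. *Algorithm (data-based policy iteration).* Starting from $K^0$, for $i=0,1,2,\dots$ let $\Sigma^i$ be a solution of $$(\Phi_1-\mathcal B_F(K^i\Phi_0+U_0))^\top\Sigma^i\Phi_0+\Phi_0^\top\Sigma^i(\Phi_1-\mathcal B_F(K^i\Phi_0+U_0))+Y_0^\top QY_0+\Phi_0^\top(K^i)^\top RK^i\Phi_0=0,$$ and let $K^{i+1}=R^{-1}\mathcal B_F^\top\Sigma^i$. **Proposition.** Let $K^0$ be stabilizing. Then the algorithm can be run, and $\Sigma^i$ is the unique solution of the data equation at every step. The Riccati equation $\mathcal A_F^\top\Sigma+\Sigma\mathcal A_F+Q_\phi-\Sigma\mathcal B_FR^{-1}\mathcal B_F^\top\Sigma=0$ has exactly one symmetric positive semidefinite solution $\Sigma^*$; the gain $K^*=R^{-1}\mathcal B_F^\top\Sigma^*$ is stabilizing and is the unique optimal gain, and $J(\phi_0,K^*)=\phi_0^\top\Sigma^*\phi_0$ for all $\phi_0$. Every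 gain $K^i$ is stabilizing, every $\Sigma^i$ is symmetric positive semidefinite, $\Sigma^{i+1}\preceq\Sigma^i$ for all $i$, and $\Sigma^i\to\Sigma^*$, $K^i\to K^*$ as $i\to\infty$. -/

import Mathlib

open scoped Matrix

namespace DataLQR

noncomputable section

/-- All complex eigenvalues of the real square matrix `M` lie in the open left half-plane. -/
def IsHurwitz {ι : Type*} [Fintype ι] [DecidableEq ι] (M : Matrix ι ι ℝ) : Prop :=
  ∀ z ∈ spectrum ℂ (M.map (algebraMap ℝ ℂ)), z.re < 0

/-- The pair `(A, B)` is controllable: the matrix `[B, A B, …, A ^ (n - 1) B]` has rank `n`. -/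
def IsControllable {n : ℕ} {κ : Type*} [Fintype κ]
    (A : Matrix (Fin n) (Fin n) ℝ) (B : Matrix (Fin n) κ ℝ) : Prop :=
  (Matrix.of fun (i : Fin n) (k : Fin n × κ) => (A ^ (k.1 : ℕ) * B) i k.2).rank = n

/-- The pair `(A, C)` is observable: the stacked matrix `[C; C A; …; C A ^ (n - 1)]` has
rank `n`. -/
def IsObservable {n : ℕ} {κ : Type*} [Fintype κ]
    (A : Matrix (Fin n) (Fin n) ℝ) (C : Matrix κ (Fin n) ℝ) : Prop :=
  (Matrix.of fun (k : Fin n × κ) (j : Fin n) => (C * A ^ (k.1 : ℕ)) k.2 j).rank = n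

open scoped MatrixOrder in
/-- The symmetric positive semidefinite square root of a positive semidefinite matrix. -/
def psdSqrt {n : ℕ} (M : Matrix (Fin n) (Fin n) ℝ) : Matrix (Fin n) (Fin n) ℝ := CFC.sqrt M

/-- The signal `u` is persistently exciting of order `N` on `I`: it is `N - 1` times continuously
differentiable there, and `u, u', …, u^(N-1)` (all components) are linearly independent as
functions on `I`. -/
def IsPersistentlyExciting {m : ℕ} (N : ℕ) (I : Set ℝ) (u : ℝ → Fin m → ℝ) : Prop :=
  ContDiffOn ℝ ((N - 1 : ℕ) : WithTop ℕ∞) u I ∧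
    ∀ ν : Fin N → Fin m → ℝ,
      (∀ t ∈ I, ∑ k : Fin N, ν k ⬝ᵥ iteratedDerivWithin (k : ℕ) u I t = 0) → ν = 0

/-- The coefficient `D_k` of `s ^ k` in the matrix polynomial `adj (s I - M)`. -/
def adjCoeff {n : ℕ} (M : Matrix (Fin n) (Fin n) ℝ) (k : ℕ) : Matrix (Fin n) (Fin n) ℝ :=
  M.charmatrix.adjugate.map fun q => q.coeff k

/-- The square matrix `[D_0, …, D_{n-1}] (I_n ⊗ v) = [D_0 v, …, D_{n-1} v]`. -/
def adjKrylov {n : ℕ} (M : Matrix (Fin n) (Fin n) ℝ) (v : Fin n → ℝ) :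
    Matrix (Fin n) (Fin n) ℝ :=
  Matrix.of fun i k => (adjCoeff M (k : ℕ) *ᵥ v) i

/-- Coordinates of the substitute state `η = (η^u, η^y, η^ε)`: an `n`-vector for every input
channel, an `n`-vector for every output channel, and the `n`-vector `η^ε`. -/
abbrev EtaIdx (n m p : ℕ) : Type := ((Fin m ⊕ Fin p) × Fin n) ⊕ Fin n

/-- The parameterization matrix `S = [S^u, S^y, S^ε]`; `M` stands for `A - L C`, `ε₀` is the initial
observation error and `η₀` the initial value of `η^ε`. -/
def stateParam {n m p : ℕ} (M : Matrix (Fin n) (Fin n) ℝ) (B : Matrix (Fin n) (Fin m) ℝ)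
    (L : Matrix (Fin n) (Fin p) ℝ) (Aε : Matrix (Fin n) (Fin n) ℝ) (ε₀ η₀ : Fin n → ℝ) :
    Matrix (Fin n) (EtaIdx n m p) ℝ :=
  Matrix.of fun r c =>
    match c with
    | Sum.inl (Sum.inl i, k) => adjKrylov M (B.col i) r k
    | Sum.inl (Sum.inr j, k) => adjKrylov M (L.col j) r k
    | Sum.inr k => (adjKrylov M ε₀ * (adjKrylov Aε η₀)⁻¹) r k

/-- The companion matrix `A_s` (ones on the superdiagonal, last row `-a_0, …, -a_{n-1}`) of
`q = s ^ n + a_{n-1} s ^ (n-1) + … + a_0`. -/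
def companion (n : ℕ) (q : Polynomial ℝ) : Matrix (Fin n) (Fin n) ℝ :=
  Matrix.of fun i j =>
    if (i : ℕ) + 1 = n then -q.coeff (j : ℕ) else if (i : ℕ) + 1 = (j : ℕ) then 1 else 0

/-- `𝒜_s = diag (I_{m+p} ⊗ A_s, A_ε)`. -/
def filterA {n : ℕ} (m p : ℕ) (q : Polynomial ℝ) (Aε : Matrix (Fin n) (Fin n) ℝ) :
    Matrix (EtaIdx n m p) (EtaIdx n m p) ℝ :=
  Matrix.fromBlocks
    (Matrix.of fun (a b : (Fin m ⊕ Fin p) × Fin n) =>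
      if a.1 = b.1 then companion n q a.2 b.2 else 0) 0 0 Aε

/-- `ℬ_s = diag (I_{m+p} ⊗ b_s, 0)` with `b_s = (0, …, 0, 1)`; its columns are indexed by the
inputs, the outputs, and `n` zero channels. -/
def filterB (n m p : ℕ) : Matrix (EtaIdx n m p) ((Fin m ⊕ Fin p) ⊕ Fin n) ℝ :=
  Matrix.fromBlocks
    (Matrix.of fun (a : (Fin m ⊕ Fin p) × Fin n) (c : Fin m ⊕ Fin p) =>
      if a.1 = c ∧ (a.2 : ℕ) + 1 = n then 1 else 0) 0 0 0

/-- The columns of `ℬ_s` that belong to the input `u`. -/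
def filterBu (n m p : ℕ) : Matrix (EtaIdx n m p) (Fin m) ℝ :=
  (filterB n m p).submatrix id fun i => Sum.inl (Sum.inl i)

/-- The columns of `ℬ_s` that belong to the output `y`. -/
def filterBy (n m p : ℕ) : Matrix (EtaIdx n m p) (Fin p) ℝ :=
  (filterB n m p).submatrix id fun j => Sum.inl (Sum.inr j)

/-- The data matrix `[f (t), f (t + Δt), …, f (t + (T - 1) Δt)]`. -/
def sampleMatrix {ι : Type*} (T : ℕ) (t Δt : ℝ) (f : ℝ → ι → ℝ) : Matrix ι (Fin T) ℝ :=
  Matrix.of fun i k => f (t + (k : ℕ) * Δt) i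

/-- Policy evaluation: `P` solves the data equation for the gain `K`. -/
def PolicyEvaluation {N m p T : ℕ} (Φ₀ Φ₁ : Matrix (Fin N) (Fin T) ℝ)
    (U₀ : Matrix (Fin m) (Fin T) ℝ) (Y₀ : Matrix (Fin p) (Fin T) ℝ)
    (BF : Matrix (Fin N) (Fin m) ℝ) (Q : Matrix (Fin p) (Fin p) ℝ)
    (R : Matrix (Fin m) (Fin m) ℝ) (K : Matrix (Fin m) (Fin N) ℝ)
    (P : Matrix (Fin N) (Fin N) ℝ) : Prop :=
  (Φ₁ - BF * (K * Φ₀ + U₀))ᵀ * P * Φ₀ + Φ₀ᵀ * P * (Φ₁ - BF * (K * Φ₀ + U₀))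
    + Y₀ᵀ * Q * Y₀ + Φ₀ᵀ * Kᵀ * R * K * Φ₀ = 0

/-- `(P i, K i)` is the sequence produced by the data-based policy iteration started at `K₀`
(run without the stopping test). -/
structure IsPolicyIteration {N m p T : ℕ} (Φ₀ Φ₁ : Matrix (Fin N) (Fin T) ℝ)
    (U₀ : Matrix (Fin m) (Fin T) ℝ) (Y₀ : Matrix (Fin p) (Fin T) ℝ)
    (BF : Matrix (Fin N) (Fin m) ℝ) (Q : Matrix (Fin p) (Fin p) ℝ)
    (R : Matrix (Fin m) (Fin m) ℝ) (K₀ : Matrix (Fin m) (Fin N) ℝ)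
    (P : ℕ → Matrix (Fin N) (Fin N) ℝ) (K : ℕ → Matrix (Fin m) (Fin N) ℝ) : Prop where
  init : K 0 = K₀
  evaluation : ∀ i, PolicyEvaluation Φ₀ Φ₁ U₀ Y₀ BF Q R (K i) (P i)
  improvement : ∀ i, K (i + 1) = R⁻¹ * BFᵀ * P i

/-- The cost `∫_0^∞ (φᵀ Qφ φ + uᵀ R u) dt ∈ [0, ∞]` along `φ' = AF φ + BF u`, `φ(0) = φ₀`, under the
feedback `u = -K φ`, that is, along `φ(t) = exp (t (AF - BF K)) φ₀`. -/
def feedbackCost {N m : ℕ} (AF : Matrix (Fin N) (Fin N) ℝ) (BF : Matrix (Fin N) (Fin m) ℝ)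
    (Qφ : Matrix (Fin N) (Fin N) ℝ) (R : Matrix (Fin m) (Fin m) ℝ)
    (φ₀ : Fin N → ℝ) (K : Matrix (Fin m) (Fin N) ℝ) : ENNReal :=
  ∫⁻ t in Set.Ici (0 : ℝ),
    let φ : Fin N → ℝ := NormedSpace.exp (t • (AF - BF * K)) *ᵥ φ₀
    let u : Fin m → ℝ := -(K *ᵥ φ)
    ENNReal.ofReal (φ ⬝ᵥ (Qφ *ᵥ φ) + u ⬝ᵥ (R *ᵥ u))

/-- `K` is an optimal feedback gain: from every initial state it attains the least cost among all
feedback gains. -/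
def IsOptimalGain {N m : ℕ} (AF : Matrix (Fin N) (Fin N) ℝ) (BF : Matrix (Fin N) (Fin m) ℝ)
    (Qφ : Matrix (Fin N) (Fin N) ℝ) (R : Matrix (Fin m) (Fin m) ℝ)
    (K : Matrix (Fin m) (Fin N) ℝ) : Prop :=
  ∀ (φ₀ : Fin N → ℝ) (K' : Matrix (Fin m) (Fin N) ℝ),
    feedbackCost AF BF Qφ R φ₀ K ≤ feedbackCost AF BF Qφ R φ₀ K'

/-- `P` is a positive semidefinite solution of the algebraic Riccati equation
`AFᵀ P + P AF + Qφ - P BF R⁻¹ BFᵀ P = 0`. -/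
def IsRiccatiSolution {N m : ℕ} (AF : Matrix (Fin N) (Fin N) ℝ) (BF : Matrix (Fin N) (Fin m) ℝ)
    (Qφ : Matrix (Fin N) (Fin N) ℝ) (R : Matrix (Fin m) (Fin m) ℝ)
    (P : Matrix (Fin N) (Fin N) ℝ) : Prop :=
  P.PosSemidef ∧ AFᵀ * P + P * AF + Qφ - P * BF * R⁻¹ * BFᵀ * P = 0

end

end DataLQR

/-! The data equation is turned into a Lyapunov equation for a detectable pair, and the iteration
then becomes Kleinman's.

Reduction. `S` intertwines the filter with the observer dynamics `M = A - L C`, so `x - S η` solves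
a homogeneous linear equation with initial value zero. Hence `x = S η`, and `η' = 𝒜 η + ℬ^u u` with
`𝒜 = 𝒜_s + ℬ^y C S`. Since `E₀ = F₁ᵀ Φ₀`, this gives `Φ₁ = AF Φ₀ + BF U₀` and `Y₀ = C S F₁ᵀ Φ₀`.
Cancelling `Φ₀` leaves the Lyapunov equation of `AF - BF K` with weight `Qφ + Kᵀ R K`
(`policyEvaluation_iff`).

Detectability. Let `q` be the characteristic polynomial of `M`. Filtering the state by `1/q` gives
`ξ` with `ξ' = A ξ + B η^u_0 + g_0 x₀`, where `g` carries the initial condition; the `η^y` blocks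
are `C ξ, C ξ', …`. The coordinates `(ξ, η^u, g)` describe an `𝒜`-invariant subspace of dimension at
most `(m + 2) n` that contains the trajectory. The rank assumption makes it the range of `F₁ᵀ`, so
`AF` is a restriction of `𝒜`. An unstable eigenvector of `AF` without weight goes under `S` to an
eigenvector of `A` without weight, because `S 𝒜 = A S`. Observability puts it into the kernel of
`S`, where `𝒜` acts as the Hurwitz filter matrix; so it is zero (`isDetectable_restriction`).

Iteration. The completed square `lyapunov_feedback` shows that improvement keeps stability and
decreases `Σ`; the limit of a decreasing run solves the Riccati equation. Detectability makes every
positive semidefinite solution stabilizing, so two of them differ by a solution of a homogeneous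
Sylvester equation, that is, by zero. It also forces trajectories of finite cost to zero, so the
same square bounds the cost of every gain from below, stabilizing or not
(`policyIteration_convergence`). -/

namespace DataLQR

/-! ### Eigenpairs in real form, Hurwitz matrices and the Sylvester equation -/

/-- The real form of an eigenvector `a + b i` of `A` for the eigenvalue `σ + ω i`. -/
structure IsEigenpair {ι : Type*} [Fintype ι] (A : Matrix ι ι ℝ) (σ ω : ℝ) (a b : ι → ℝ) :
    Prop where
  re : A *ᵥ a = σ • a - ω • b
  im : A *ᵥ b = ω • a + σ • b

section Eigen

variable {ι : Type*} [Fintype ι]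

theorem map_mulVec_re (A : Matrix ι ι ℝ) (v : ι → ℂ) (i : ι) :
    ((A.map (algebraMap ℝ ℂ)) *ᵥ v) i =
      ⟨(A *ᵥ fun j => (v j).re) i, (A *ᵥ fun j => (v j).im) i⟩ := by
  apply Complex.ext <;> simp [Matrix.mulVec, dotProduct]

theorem isEigenpair_iff_complex (A : Matrix ι ι ℝ) (z : ℂ) (v : ι → ℂ) :
    (A.map (algebraMap ℝ ℂ)) *ᵥ v = z • v ↔
      IsEigenpair A z.re z.im (fun j => (v j).re) (fun j => (v j).im) := by
  constructor
  · intro h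
    constructor <;> ext i
    · have := congrArg Complex.re (congrFun h i)
      rw [map_mulVec_re] at this
      simpa using this
    · have := congrArg Complex.im (congrFun h i)
      rw [map_mulVec_re] at this
      simp at this ⊢
      linarith
  · rintro ⟨h1, h2⟩
    ext i
    rw [map_mulVec_re, h1, h2]
    apply Complex.ext <;> simp
    ring

theorem dotProduct_lyapunov (A P : Matrix ι ι ℝ) (x : ι → ℝ) :
    x ⬝ᵥ ((Aᵀ * P + P * A) *ᵥ x) = (A *ᵥ x) ⬝ᵥ (P *ᵥ x) + x ⬝ᵥ (P *ᵥ (A *ᵥ x)) := by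
  simp only [Matrix.add_mulVec, dotProduct_add, ← Matrix.mulVec_mulVec]
  rw [Matrix.dotProduct_mulVec, Matrix.vecMul_transpose]

theorem dotProduct_mulVec_comm_of_isSymm {P : Matrix ι ι ℝ} (hP : P.IsSymm) (x y : ι → ℝ) :
    x ⬝ᵥ (P *ᵥ y) = y ⬝ᵥ (P *ᵥ x) := by
  rw [Matrix.dotProduct_mulVec, ← Matrix.mulVec_transpose, hP.eq, dotProduct_comm]

/-- Summing over the real and the imaginary part makes the `ω` terms cancel by symmetry of `P`; what
remains is growth at rate `2σ`. -/
theorem IsEigenpair.dotProduct_lyapunov {A P : Matrix ι ι ℝ} (hP : P.IsSymm) {σ ω : ℝ}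
    {a b : ι → ℝ} (h : IsEigenpair A σ ω a b) :
    a ⬝ᵥ ((Aᵀ * P + P * A) *ᵥ a) + b ⬝ᵥ ((Aᵀ * P + P * A) *ᵥ b) =
      2 * σ * (a ⬝ᵥ (P *ᵥ a) + b ⬝ᵥ (P *ᵥ b)) := by
  rw [DataLQR.dotProduct_lyapunov, DataLQR.dotProduct_lyapunov, h.re, h.im]
  simp only [Matrix.mulVec_sub, Matrix.mulVec_add, Matrix.mulVec_smul, dotProduct_sub,
    dotProduct_add, sub_dotProduct, add_dotProduct, dotProduct_smul, smul_dotProduct, smul_eq_mul]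
  rw [dotProduct_mulVec_comm_of_isSymm hP b a]
  ring

theorem posSemidef_iff_isSymm {P : Matrix ι ι ℝ} :
    P.PosSemidef ↔ P.IsSymm ∧ ∀ x, 0 ≤ x ⬝ᵥ (P *ᵥ x) := by
  rw [Matrix.posSemidef_iff_dotProduct_mulVec]
  simp [Matrix.IsHermitian, Matrix.IsSymm]

theorem _root_.Matrix.PosSemidef.isSymm_real {P : Matrix ι ι ℝ} (hP : P.PosSemidef) : P.IsSymm :=
  (posSemidef_iff_isSymm.1 hP).1

theorem mulVec_eq_zero_of_posSemidef {P : Matrix ι ι ℝ} (hP : P.PosSemidef) {x : ι → ℝ}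
    (h : x ⬝ᵥ (P *ᵥ x) ≤ 0) : P *ᵥ x = 0 :=
  (hP.dotProduct_mulVec_zero_iff x).1 (le_antisymm h ((posSemidef_iff_isSymm.1 hP).2 x))

theorem dotProduct_transpose_mul_mul {κ : Type*} [Fintype κ] (K : Matrix κ ι ℝ) (R : Matrix κ κ ℝ)
    (x : ι → ℝ) : x ⬝ᵥ ((Kᵀ * R * K) *ᵥ x) = (K *ᵥ x) ⬝ᵥ (R *ᵥ (K *ᵥ x)) := by
  simp only [← Matrix.mulVec_mulVec]
  rw [Matrix.dotProduct_mulVec, Matrix.vecMul_transpose]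

theorem posSemidef_transpose_mul_mul {κ : Type*} [Fintype κ] {R : Matrix κ κ ℝ}
    (hR : R.PosSemidef) (K : Matrix κ ι ℝ) : (Kᵀ * R * K).PosSemidef := by
  simpa using hR.conjTranspose_mul_mul_same K

theorem mulVec_eq_zero_of_posDef {κ : Type*} [Fintype κ] [DecidableEq κ] {R : Matrix κ κ ℝ}
    (hR : R.PosDef) {K : Matrix κ ι ℝ} {x : ι → ℝ} (h : (Kᵀ * R * K) *ᵥ x = 0) : K *ᵥ x = 0 := by
  by_contra hne
  have h1 := hR.dotProduct_mulVec_pos hne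
  have h2 := dotProduct_transpose_mul_mul K R x
  rw [h] at h2
  simp at h1 h2
  linarith

theorem mulVec_eq_zero_of_add_mulVec_eq_zero {P Q : Matrix ι ι ℝ} (hP : P.PosSemidef)
    (hQ : Q.PosSemidef) {x : ι → ℝ} (h : (P + Q) *ᵥ x = 0) : P *ᵥ x = 0 ∧ Q *ᵥ x = 0 := by
  have h1 : x ⬝ᵥ (P *ᵥ x) + x ⬝ᵥ (Q *ᵥ x) = 0 := by
    rw [← dotProduct_add, ← Matrix.add_mulVec, h, dotProduct_zero]
  have h2 := (posSemidef_iff_isSymm.1 hP).2 x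
  have h3 := (posSemidef_iff_isSymm.1 hQ).2 x
  exact ⟨mulVec_eq_zero_of_posSemidef hP (by linarith),
    mulVec_eq_zero_of_posSemidef hQ (by linarith)⟩

/-- A positive semidefinite solution of a Lyapunov equation forces the weight to vanish on the
eigenvectors of the closed right half-plane. -/
theorem IsEigenpair.weight_eq_zero {A P Q : Matrix ι ι ℝ} (hP : P.PosSemidef) (hQ : Q.PosSemidef)
    (hl : Aᵀ * P + P * A + Q = 0) {σ ω : ℝ} (hσ : 0 ≤ σ) {a b : ι → ℝ}
    (h : IsEigenpair A σ ω a b) : Q *ᵥ a = 0 ∧ Q *ᵥ b = 0 := by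
  have h1 := h.dotProduct_lyapunov hP.isSymm_real
  rw [eq_neg_of_add_eq_zero_left hl] at h1
  simp only [Matrix.neg_mulVec, dotProduct_neg] at h1
  have hPa := (posSemidef_iff_isSymm.1 hP).2 a
  have hPb := (posSemidef_iff_isSymm.1 hP).2 b
  have hQa := (posSemidef_iff_isSymm.1 hQ).2 a
  have hQb := (posSemidef_iff_isSymm.1 hQ).2 b
  have : 0 ≤ 2 * σ * (a ⬝ᵥ (P *ᵥ a) + b ⬝ᵥ (P *ᵥ b)) := by positivity
  exact ⟨mulVec_eq_zero_of_posSemidef hQ (by linarith),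
    mulVec_eq_zero_of_posSemidef hQ (by linarith)⟩

variable [DecidableEq ι]

theorem mem_spectrum_iff_exists_mulVec (M : Matrix ι ι ℂ) (z : ℂ) :
    z ∈ spectrum ℂ M ↔ ∃ v, v ≠ 0 ∧ M *ᵥ v = z • v := by
  rw [spectrum.mem_iff, Matrix.isUnit_iff_isUnit_det, isUnit_iff_ne_zero, not_not,
    ← Matrix.exists_mulVec_eq_zero_iff]
  simp only [Matrix.sub_mulVec, Algebra.algebraMap_eq_smul_one, Matrix.smul_mulVec,
    Matrix.one_mulVec, sub_eq_zero, eq_comm]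

/-- This real form lets all later eigenvector arguments stay in real subspaces. -/
theorem isHurwitz_iff (A : Matrix ι ι ℝ) : IsHurwitz A ↔
    ∀ σ ω a b, 0 ≤ σ → IsEigenpair A σ ω a b → a = 0 ∧ b = 0 := by
  constructor
  · intro h σ ω a b hσ hab
    by_contra hne
    have := h ⟨σ, ω⟩ ((mem_spectrum_iff_exists_mulVec _ _).2
      ⟨fun j => ⟨a j, b j⟩, ?_, (isEigenpair_iff_complex _ _ _).2 hab⟩)
    · exact absurd hσ (not_le.2 this)
    · intro h0
      apply hne
      constructor <;> ext i
      · simpa using congrArg Complex.re (congrFun h0 i)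
      · simpa using congrArg Complex.im (congrFun h0 i)
  · intro h z hz
    obtain ⟨v, hv, hvz⟩ := (mem_spectrum_iff_exists_mulVec _ _).1 hz
    by_contra! hre
    obtain ⟨h1, h2⟩ := h _ _ _ _ hre ((isEigenpair_iff_complex _ _ _).1 hvz)
    apply hv
    ext i
    exact Complex.ext (congrFun h1 i) (congrFun h2 i)

theorem IsHurwitz.of_charpoly_eq {A B : Matrix ι ι ℝ} (hA : IsHurwitz A)
    (h : B.charpoly = A.charpoly) : IsHurwitz B := by
  intro z hz
  apply hA z
  rw [Matrix.mem_spectrum_iff_isRoot_charpoly] at hz ⊢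
  rwa [Matrix.charpoly_map, h, ← Matrix.charpoly_map] at hz

/-- Uniqueness for the Sylvester equation of two Hurwitz matrices. -/
theorem sylvester_eq_zero {A B X : Matrix ι ι ℝ} (hA : IsHurwitz A) (hB : IsHurwitz B)
    (h : Aᵀ * X + X * B = 0) : X = 0 := by
  let φ : Matrix ι ι ℝ →+* Matrix ι ι ℂ := (algebraMap ℝ ℂ).mapMatrix
  have hinj : Function.Injective φ := Matrix.map_injective (algebraMap ℝ ℂ).injective
  set A' := φ A
  set B' := φ B
  set X' := φ X
  have hX : A'ᵀ * X' = X' * (-B') := by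
    have h1 := congrArg φ h
    have h2 : φ Aᵀ = A'ᵀ := by ext; simp [φ, A']
    rw [map_add, map_mul, map_mul, map_zero, h2] at h1
    rw [mul_neg]
    exact eq_neg_of_add_eq_zero_left h1
  -- `X` intertwines `Aᵀ` with `-B`, hence also every polynomial in them. For the characteristic
  -- polynomial of `A` the left side vanishes by Cayley–Hamilton, while the right factor is
  -- invertible: the spectra of `A` and `-B` lie in opposite open half-planes.
  have hpow : ∀ q : Polynomial ℂ, Polynomial.aeval A'ᵀ q * X' = X' * Polynomial.aeval (-B') q := by
    intro q
    induction q using Polynomial.induction_on' with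
    | add p q hp hq => simp only [map_add, add_mul, mul_add, hp, hq]
    | monomial k c =>
      have : A'ᵀ ^ k * X' = X' * (-B') ^ k := by
        induction k with
        | zero => simp
        | succ k ih => rw [pow_succ, pow_succ, mul_assoc, hX, ← mul_assoc, ih, mul_assoc]
      simp only [Polynomial.aeval_monomial, Algebra.algebraMap_eq_smul_one, smul_mul_assoc, one_mul,
        mul_smul_comm, this]
  have h0 := hpow A'.charpoly
  rw [← Matrix.charpoly_transpose, Matrix.aeval_self_charpoly, zero_mul] at h0
  have hu : IsUnit (Polynomial.aeval (-B') A'ᵀ.charpoly) := by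
    rw [← spectrum.zero_notMem_iff ℂ]
    intro hz
    -- The spectral mapping theorem needs a nonempty spectrum, so size zero is split off.
    by_cases hn : Nonempty ι
    · rw [spectrum.map_polynomial_aeval_of_nonempty _ _
        (spectrum.nonempty_of_isAlgClosed_of_finiteDimensional ℂ (-B'))] at hz
      obtain ⟨z, hz, hz0⟩ := hz
      have h1 : z ∈ spectrum ℂ A' := by
        rw [Matrix.charpoly_transpose] at hz0
        exact Matrix.mem_spectrum_iff_isRoot_charpoly.2 hz0
      have h2 : -z ∈ spectrum ℂ B' := by
        rw [← spectrum.neg_eq] at hz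
        exact hz
      have := hA _ h1
      have := hB _ h2
      simp at this
      linarith
    · rw [not_nonempty_iff] at hn
      simp at hz
  apply hinj
  rw [map_zero]
  exact (hu.mul_left_eq_zero).1 h0.symm

end Eigen

/-! ### Decay of the matrix exponential on invariant subspaces -/

section Exponential

open Filter Topology

variable {ι : Type*} [Fintype ι] [DecidableEq ι]

section Norm

attribute [local instance] Matrix.linftyOpNormedRing Matrix.linftyOpNormedAlgebra

theorem hasDerivAt_exp_mulVec (A : Matrix ι ι ℝ) (x : ι → ℝ) (t : ℝ) :
    HasDerivAt (fun s : ℝ => NormedSpace.exp (s • A) *ᵥ x)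
      (A *ᵥ (NormedSpace.exp (t • A) *ᵥ x)) t := by
  have h := hasDerivAt_exp_smul_const' (𝕂 := ℝ) A t
  have h2 := ((LinearMap.toContinuousLinearMap
    ((Matrix.mulVecBilin ℝ ℝ).flip x : Matrix ι ι ℝ →ₗ[ℝ] ι → ℝ)).hasFDerivAt).comp_hasDerivAt t h
  rw [Matrix.mulVec_mulVec]
  exact h2

theorem exp_smul_mulVec_of_pow_mulVec_eq_zero (N : Matrix ι ι ℂ) (x : ι → ℂ) (k : ℕ)
    (h : N ^ k *ᵥ x = 0) (t : ℝ) :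
    NormedSpace.exp (t • N) *ᵥ x =
      ∑ j ∈ Finset.range k, ((j.factorial : ℝ)⁻¹ * t ^ j) • (N ^ j *ᵥ x) := by
  have h1 := NormedSpace.exp_series_hasSum_exp' (𝕂 := ℝ) (t • N)
  have h2 := h1.mapL (LinearMap.toContinuousLinearMap
    ((Matrix.mulVecBilin ℝ ℝ).flip x : Matrix ι ι ℂ →ₗ[ℝ] ι → ℂ))
  have h3 : ∀ j, k ≤ j → N ^ j *ᵥ x = 0 := by
    intro j hj
    rw [← Nat.sub_add_cancel hj, pow_add, ← Matrix.mulVec_mulVec, h, Matrix.mulVec_zero]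
  have h4 : ∀ j, (LinearMap.toContinuousLinearMap
    ((Matrix.mulVecBilin ℝ ℝ).flip x : Matrix ι ι ℂ →ₗ[ℝ] ι → ℂ))
      ((j.factorial : ℝ)⁻¹ • (t • N) ^ j) = ((j.factorial : ℝ)⁻¹ * t ^ j) • (N ^ j *ᵥ x) := by
    intro j
    change ((j.factorial : ℝ)⁻¹ • (t • N) ^ j) *ᵥ x = _
    rw [smul_pow, smul_smul, Matrix.smul_mulVec]
  simp only [h4] at h2
  refine h2.unique (hasSum_sum_of_ne_finset_zero ?_)
  intro j hj
  rw [h3 j (by simpa using hj), smul_zero]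

theorem exp_smul_eq (A : Matrix ι ι ℂ) (μ : ℂ) (t : ℝ) :
    NormedSpace.exp (t • A) = Complex.exp (t * μ) • NormedSpace.exp (t • (A - μ • 1)) := by
  have h : t • A = algebraMap ℂ (Matrix ι ι ℂ) (t * μ) + t • (A - μ • 1) := by
    rw [Algebra.algebraMap_eq_smul_one, mul_smul, Complex.coe_smul, smul_sub]
    abel
  have hc : Commute (algebraMap ℂ (Matrix ι ι ℂ) (t * μ)) (t • (A - μ • 1)) :=
    Algebra.commutes' _ _
  have he : NormedSpace.exp (algebraMap ℂ (Matrix ι ι ℂ) (t * μ)) =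
      algebraMap ℂ (Matrix ι ι ℂ) (NormedSpace.exp (t * μ)) :=
    (NormedSpace.map_exp (algebraMap ℂ (Matrix ι ι ℂ)) (continuous_algebraMap _ _) (t * μ)).symm
  rw [h, Matrix.exp_add_of_commute _ _ hc, he, ← Complex.exp_eq_exp_ℂ, Algebra.algebraMap_eq_smul_one, smul_mul_assoc, one_mul]

theorem exp_smul_map (A : Matrix ι ι ℝ) (t : ℝ) :
    (NormedSpace.exp (t • A)).map (algebraMap ℝ ℂ) =
      NormedSpace.exp (t • A.map (algebraMap ℝ ℂ)) := by
  have h := NormedSpace.map_exp (𝔸 := Matrix ι ι ℝ) (algebraMap ℝ ℂ).mapMatrix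
    (continuous_id.matrix_map Complex.continuous_ofReal) (t • A)
  have h2 : (algebraMap ℝ ℂ).mapMatrix (t • A) = t • A.map (algebraMap ℝ ℂ) := by
    ext; simp
  rwa [h2] at h

end Norm

theorem tendsto_pow_mul_cexp (μ : ℂ) (hμ : μ.re < 0) (j : ℕ) (c : ℝ) :
    Tendsto (fun t : ℝ => Complex.exp (t * μ) * ((c * t ^ j : ℝ) : ℂ)) atTop (𝓝 0) := by
  rw [tendsto_zero_iff_norm_tendsto_zero]
  have h := (Real.tendsto_pow_mul_exp_neg_atTop_nhds_zero j).comp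
    (tendsto_id.const_mul_atTop (neg_pos.2 hμ))
  have h2 := (h.const_mul (|c| * ((-μ.re) ^ j)⁻¹))
  rw [mul_zero] at h2
  refine h2.congr' ?_
  filter_upwards [eventually_ge_atTop 0] with t ht
  have hp : (-μ.re) ^ j ≠ 0 := (pow_pos (neg_pos.2 hμ) j).ne'
  simp only [Function.comp, id, norm_mul, Complex.norm_exp, Complex.norm_real, Real.norm_eq_abs,
    abs_pow, abs_of_nonneg ht, mul_pow]
  rw [show ((t : ℂ) * μ).re = -(-μ.re * t) by simp; ring]
  field_simp

/-- On a generalized eigenvector the flow is `exp (t μ)` times a polynomial in `t`, because the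
series of the nilpotent part terminates. -/
theorem tendsto_exp_mulVec_of_pow_mulVec_eq_zero (A : Matrix ι ι ℂ) (μ : ℂ) (hμ : μ.re < 0)
    (x : ι → ℂ) (k : ℕ) (h : (A - μ • 1) ^ k *ᵥ x = 0) :
    Tendsto (fun t : ℝ => NormedSpace.exp (t • A) *ᵥ x) atTop (𝓝 0) := by
  simp only [exp_smul_eq A μ, Matrix.smul_mulVec,
    exp_smul_mulVec_of_pow_mulVec_eq_zero _ x k h, Finset.smul_sum]
  rw [← Finset.sum_const_zero (s := Finset.range k)]
  refine tendsto_finsetSum _ fun j _ => ?_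
  have := (tendsto_pow_mul_cexp μ hμ j (j.factorial : ℝ)⁻¹).smul_const
    ((A - μ • 1) ^ j *ᵥ x)
  rw [zero_smul] at this
  refine this.congr fun t => ?_
  rw [mul_smul, Complex.coe_smul]

/-- `W` is spanned by the generalized eigenspaces of the restriction of `A`. Each nonzero one
contains a true eigenvector in `W`, so its eigenvalue has negative real part. -/
theorem tendsto_exp_mulVec_complex (A : Matrix ι ι ℂ) (W : Submodule ℂ (ι → ℂ))
    (hW : ∀ x ∈ W, A *ᵥ x ∈ W)
    (h : ∀ v ∈ W, ∀ z : ℂ, v ≠ 0 → A *ᵥ v = z • v → z.re < 0) :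
    ∀ x ∈ W, Tendsto (fun t : ℝ => NormedSpace.exp (t • A) *ᵥ x) atTop (𝓝 0) := by
  let f : Module.End ℂ W := (Matrix.toLin' A).restrict hW
  have hf : ∀ w : W, (f w : ι → ℂ) = A *ᵥ w := fun w => rfl
  suffices H : ∀ w : W, Tendsto (fun t : ℝ => NormedSpace.exp (t • A) *ᵥ (w : ι → ℂ)) atTop (𝓝 0)
    from fun x hx => H ⟨x, hx⟩
  intro w
  have hw : w ∈ ⨆ μ : ℂ, f.maxGenEigenspace μ := by
    rw [Module.End.iSup_maxGenEigenspace_eq_top]; trivial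
  induction hw using Submodule.iSup_induction' with
  | zero => simp
  | add x y _ _ hx hy => simpa [Matrix.mulVec_add] using hx.add hy
  | mem μ y hy =>
    obtain ⟨k, hk⟩ := (Module.End.mem_maxGenEigenspace f μ y).1 hy
    have hpow : ∀ (k : ℕ) (y : W), (((f - μ • 1) ^ k) y : ι → ℂ) = (A - μ • 1) ^ k *ᵥ y := by
      intro k
      induction k with
      | zero => simp
      | succ k ih =>
        intro y
        rw [pow_succ, Module.End.mul_apply, ih, pow_succ, ← Matrix.mulVec_mulVec]
        congr 1
        simp [hf, Matrix.sub_mulVec, Matrix.smul_mulVec]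
    by_cases hy0 : y = 0
    · simp [hy0]
    · have hev : f.HasEigenvalue μ := by
        refine Module.End.hasEigenvalue_of_hasGenEigenvalue (k := k) ?_
        intro hbot
        have : y ∈ f.genEigenspace μ k := by
          rw [Module.End.mem_genEigenspace_nat]
          exact hk
        rw [hbot] at this
        exact hy0 this
      obtain ⟨v, hv⟩ := hev.exists_hasEigenvector
      have hμ : μ.re < 0 := by
        refine h v v.2 μ (fun h0 => hv.2 (Subtype.ext h0)) ?_
        rw [← hf, hv.apply_eq_smul]
        rfl
      refine tendsto_exp_mulVec_of_pow_mulVec_eq_zero A μ hμ y k ?_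
      rw [← hpow, hk]
      rfl

/-- On an invariant subspace without eigenvectors of the closed right half-plane, the flow of
`x' = A x` tends to zero. -/
theorem tendsto_exp_mulVec (A : Matrix ι ι ℝ) (V : Submodule ℝ (ι → ℝ))
    (hV : ∀ x ∈ V, A *ᵥ x ∈ V)
    (h : ∀ σ ω, ∀ a ∈ V, ∀ b ∈ V, 0 ≤ σ → IsEigenpair A σ ω a b → a = 0 ∧ b = 0)
    (x : ι → ℝ) (hx : x ∈ V) :
    Tendsto (fun t : ℝ => NormedSpace.exp (t • A) *ᵥ x) atTop (𝓝 0) := by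
  -- The complexification `V + i V`.
  let W : Submodule ℂ (ι → ℂ) :=
    { carrier := {v | (fun j => (v j).re) ∈ V ∧ (fun j => (v j).im) ∈ V}
      add_mem' := fun {v w} hv hw => ⟨V.add_mem hv.1 hw.1, V.add_mem hv.2 hw.2⟩
      zero_mem' := ⟨V.zero_mem, V.zero_mem⟩
      smul_mem' := by
        intro c v hv
        constructor
        · have := V.sub_mem (V.smul_mem c.re hv.1) (V.smul_mem c.im hv.2)
          convert! this using 1
        · have := V.add_mem (V.smul_mem c.re hv.2) (V.smul_mem c.im hv.1)
          convert! this using 1 }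
  have key := tendsto_exp_mulVec_complex (A.map (algebraMap ℝ ℂ)) W ?_ ?_ (fun j => (x j : ℂ)) ?_
  · rw [tendsto_pi_nhds] at key ⊢
    intro i
    have := (Complex.continuous_re.tendsto _).comp (key i)
    refine this.congr fun t => ?_
    rw [Function.comp, ← exp_smul_map, map_mulVec_re]
    simp
  · intro v hv
    constructor
    · simp only [map_mulVec_re]
      exact hV _ hv.1
    · simp only [map_mulVec_re]
      exact hV _ hv.2
  · intro v hv z hv0 hvz
    by_contra! hz
    obtain ⟨h1, h2⟩ := h _ _ _ hv.1 _ hv.2 hz ((isEigenpair_iff_complex _ _ _).1 hvz)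
    apply hv0
    ext i
    exact Complex.ext (congrFun h1 i) (congrFun h2 i)
  · refine ⟨by simpa using hx, ?_⟩
    have : (fun j => ((x j : ℂ)).im) = 0 := by ext; simp
    rw [this]
    exact V.zero_mem

theorem IsHurwitz.tendsto_exp_mulVec {A : Matrix ι ι ℝ} (hA : IsHurwitz A) (x : ι → ℝ) :
    Tendsto (fun t : ℝ => NormedSpace.exp (t • A) *ᵥ x) atTop (𝓝 0) :=
  DataLQR.tendsto_exp_mulVec A ⊤ (fun _ _ => trivial)
    (fun σ ω a _ b _ => (isHurwitz_iff A).1 hA σ ω a b) x trivial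

end Exponential

/-! ### Quadratic costs along a linear flow and the Lyapunov equation -/

section Cost

open Filter Topology MeasureTheory

variable {ι : Type*} [Fintype ι]

/-- The flow of `A` has no eigenvector of the closed right half-plane in the kernel of `Q`. -/
def IsDetectable (A Q : Matrix ι ι ℝ) : Prop :=
  ∀ σ ω a b, 0 ≤ σ → IsEigenpair A σ ω a b → Q *ᵥ a = 0 → Q *ᵥ b = 0 → a = 0 ∧ b = 0

theorem hasDerivAt_dotProduct {f g f' g' : ℝ → ι → ℝ} {t : ℝ} (hf : HasDerivAt f (f' t) t)
    (hg : HasDerivAt g (g' t) t) :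
    HasDerivAt (fun s => f s ⬝ᵥ g s) (f' t ⬝ᵥ g t + f t ⬝ᵥ g' t) t := by
  rw [hasDerivAt_pi] at hf hg
  simp only [dotProduct, ← Finset.sum_add_distrib]
  exact HasDerivAt.fun_sum fun i _ => (hf i).mul (hg i)

theorem HasDerivAt.matrix_mulVec {κ : Type*} [Fintype κ] {f : ℝ → ι → ℝ} {f' : ι → ℝ} {t : ℝ}
    (M : Matrix κ ι ℝ) (hf : HasDerivAt f f' t) :
    HasDerivAt (fun s => M *ᵥ f s) (M *ᵥ f') t :=
  (LinearMap.toContinuousLinearMap (Matrix.mulVecLin M)).hasFDerivAt.comp_hasDerivAt t hf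

theorem quadratic_add_le {Q : Matrix ι ι ℝ} (hQ : Q.PosSemidef) (x y : ι → ℝ) :
    (x + y) ⬝ᵥ (Q *ᵥ (x + y)) ≤ 2 * (x ⬝ᵥ (Q *ᵥ x)) + 2 * (y ⬝ᵥ (Q *ᵥ y)) := by
  have h := (posSemidef_iff_isSymm.1 hQ).2 (x - y)
  simp only [Matrix.mulVec_sub, Matrix.mulVec_add, dotProduct_sub, dotProduct_add, sub_dotProduct,
    add_dotProduct] at h ⊢
  linarith

variable [DecidableEq ι]

/-- The cost `∫_0^∞ xᵀ Q x dt` along `x' = A x`, `x(0) = x₀`. -/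
noncomputable def flowCost (A Q : Matrix ι ι ℝ) (x₀ : ι → ℝ) : ENNReal :=
  ∫⁻ t in Set.Ici (0 : ℝ), ENNReal.ofReal
    ((NormedSpace.exp (t • A) *ᵥ x₀) ⬝ᵥ (Q *ᵥ (NormedSpace.exp (t • A) *ᵥ x₀)))

theorem hasDerivAt_exp_quadratic (A P : Matrix ι ι ℝ) (x : ι → ℝ) (t : ℝ) :
    HasDerivAt (fun s : ℝ => (NormedSpace.exp (s • A) *ᵥ x) ⬝ᵥ
        (P *ᵥ (NormedSpace.exp (s • A) *ᵥ x)))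
      ((NormedSpace.exp (t • A) *ᵥ x) ⬝ᵥ
        ((Aᵀ * P + P * A) *ᵥ (NormedSpace.exp (t • A) *ᵥ x))) t := by
  rw [dotProduct_lyapunov]
  have h := hasDerivAt_exp_mulVec A x
  exact hasDerivAt_dotProduct (f' := fun t => A *ᵥ (NormedSpace.exp (t • A) *ᵥ x))
    (g' := fun t => P *ᵥ (A *ᵥ (NormedSpace.exp (t • A) *ᵥ x))) (h t)
    (HasDerivAt.matrix_mulVec P (h t))

theorem continuous_exp_quadratic (A P : Matrix ι ι ℝ) (x : ι → ℝ) :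
    Continuous (fun s : ℝ => (NormedSpace.exp (s • A) *ᵥ x) ⬝ᵥ
        (P *ᵥ (NormedSpace.exp (s • A) *ᵥ x))) :=
  continuous_iff_continuousAt.2 fun t => (hasDerivAt_exp_quadratic A P x t).continuousAt

theorem tendsto_exp_quadratic {A : Matrix ι ι ℝ} {x : ι → ℝ}
    (h : Tendsto (fun t : ℝ => NormedSpace.exp (t • A) *ᵥ x) atTop (𝓝 0)) (P : Matrix ι ι ℝ) :
    Tendsto (fun t : ℝ => (NormedSpace.exp (t • A) *ᵥ x) ⬝ᵥ
      (P *ᵥ (NormedSpace.exp (t • A) *ᵥ x))) atTop (𝓝 0) := by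
  have hc : Continuous fun y : ι → ℝ => y ⬝ᵥ (P *ᵥ y) := by fun_prop
  have h2 := (hc.tendsto 0).comp h
  rwa [zero_dotProduct] at h2

/-- Along the flow `xᵀ P x` has derivative `-xᵀ Q x` and tends to zero, so the cost integral
telescopes. Nothing is assumed about the sign of `P`; it comes out of the integral. -/
theorem flowCost_eq {A P Q : Matrix ι ι ℝ} (hQ : Q.PosSemidef) (hl : Aᵀ * P + P * A + Q = 0)
    {x : ι → ℝ} (h : Tendsto (fun t : ℝ => NormedSpace.exp (t • A) *ᵥ x) atTop (𝓝 0)) :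
    0 ≤ x ⬝ᵥ (P *ᵥ x) ∧ flowCost A Q x = ENNReal.ofReal (x ⬝ᵥ (P *ᵥ x)) := by
  have hd := fun t => (hasDerivAt_exp_quadratic A P x t).neg
  have hQ0 := (posSemidef_iff_isSymm.1 hQ).2
  have hneg : ∀ y : ι → ℝ, -(y ⬝ᵥ ((Aᵀ * P + P * A) *ᵥ y)) = y ⬝ᵥ (Q *ᵥ y) := by
    intro y
    rw [eq_neg_of_add_eq_zero_left hl, Matrix.neg_mulVec, dotProduct_neg, neg_neg]
  simp only [hneg] at hd
  have ht := (tendsto_exp_quadratic h P).neg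
  rw [neg_zero] at ht
  have hi : IntegrableOn (fun t : ℝ => (NormedSpace.exp (t • A) *ᵥ x) ⬝ᵥ
      (Q *ᵥ (NormedSpace.exp (t • A) *ᵥ x))) (Set.Ioi 0) :=
    integrableOn_Ioi_deriv_of_nonneg (hd 0).continuousAt.continuousWithinAt (fun t _ => hd t)
      (fun t _ => hQ0 _) ht
  have heq := integral_Ioi_of_hasDerivAt_of_nonneg (hd 0).continuousAt.continuousWithinAt
    (fun t _ => hd t) (fun t _ => hQ0 _) ht
  simp only [zero_smul, NormedSpace.exp_zero, Matrix.one_mulVec, sub_neg_eq_add, zero_add,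
    Pi.neg_apply] at heq
  constructor
  · rw [← heq]
    exact integral_nonneg fun t => hQ0 _
  · rw [flowCost, ← restrict_Ioi_eq_restrict_Ici, ← heq,
      ofReal_integral_eq_lintegral_ofReal hi (ae_of_all _ fun t => hQ0 _)]

/-- The Lyapunov inequality bounds the cost up to time `T` from below by the drop of `xᵀ P x`; the
end term vanishes as `T → ∞`. -/
theorem le_flowCost {A P Q : Matrix ι ι ℝ} (hQ : Q.PosSemidef)
    (hl : (Aᵀ * P + P * A + Q).PosSemidef) {x : ι → ℝ}
    (h : Tendsto (fun t : ℝ => NormedSpace.exp (t • A) *ᵥ x) atTop (𝓝 0)) :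
    ENNReal.ofReal (x ⬝ᵥ (P *ᵥ x)) ≤ flowCost A Q x := by
  have ht := ENNReal.tendsto_ofReal ((tendsto_exp_quadratic h P).const_sub (x ⬝ᵥ (P *ᵥ x)))
  rw [sub_zero] at ht
  refine le_of_tendsto ht ?_
  filter_upwards [eventually_ge_atTop 0] with T hT
  have hd := fun t => (hasDerivAt_exp_quadratic A P x t).neg
  have hQ0 := (posSemidef_iff_isSymm.1 hQ).2
  have hc := continuous_exp_quadratic A Q x
  have key := intervalIntegral.sub_le_integral_of_hasDeriv_right_of_le hT
    (continuous_exp_quadratic A P x).neg.continuousOn (fun t _ => (hd t).hasDerivWithinAt)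
    (hc.integrableOn_Icc) (fun t _ => by
      have := (posSemidef_iff_isSymm.1 hl).2 (NormedSpace.exp (t • A) *ᵥ x)
      rw [Matrix.add_mulVec, dotProduct_add] at this
      linarith)
  simp only [zero_smul, NormedSpace.exp_zero, Matrix.one_mulVec, Pi.neg_apply] at key
  calc ENNReal.ofReal _ ≤ ENNReal.ofReal (∫ t in (0 : ℝ)..T, (NormedSpace.exp (t • A) *ᵥ x) ⬝ᵥ
      (Q *ᵥ (NormedSpace.exp (t • A) *ᵥ x))) := ENNReal.ofReal_le_ofReal (by linarith)
    _ = ∫⁻ t in Set.Ioc 0 T, ENNReal.ofReal ((NormedSpace.exp (t • A) *ᵥ x) ⬝ᵥ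
      (Q *ᵥ (NormedSpace.exp (t • A) *ᵥ x))) := by
      rw [intervalIntegral.integral_of_le hT, ofReal_integral_eq_lintegral_ofReal
        (hc.integrableOn_Icc.mono_set Set.Ioc_subset_Icc_self) (ae_of_all _ fun t => hQ0 _)]
    _ ≤ flowCost A Q x :=
      lintegral_mono_set (Set.Ioc_subset_Ioi_self.trans Set.Ioi_subset_Ici_self)

theorem exp_add_mulVec (A : Matrix ι ι ℝ) (s t : ℝ) (x : ι → ℝ) :
    NormedSpace.exp (s • A) *ᵥ (NormedSpace.exp (t • A) *ᵥ x) =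
      NormedSpace.exp ((s + t) • A) *ᵥ x := by
  rw [Matrix.mulVec_mulVec, add_smul, Matrix.exp_add_of_commute]
  exact (Commute.refl A).smul_left s |>.smul_right t

theorem flowCost_exp_le (A Q : Matrix ι ι ℝ) (x : ι → ℝ) {s : ℝ} (hs : 0 ≤ s) :
    flowCost A Q (NormedSpace.exp (s • A) *ᵥ x) ≤ flowCost A Q x := by
  simp only [flowCost, exp_add_mulVec]
  have hm := (measurePreserving_add_right volume s).setLIntegral_comp_preimage_emb
    (measurableEmbedding_addRight s) (fun t => ENNReal.ofReal
    ((NormedSpace.exp (t • A) *ᵥ x) ⬝ᵥ (Q *ᵥ (NormedSpace.exp (t • A) *ᵥ x)))) (Set.Ici s)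
  have hp : (fun t => t + s) ⁻¹' Set.Ici s = Set.Ici 0 := by ext; simp
  rw [hp] at hm
  rw [hm]
  exact lintegral_mono_set (Set.Ici_subset_Ici.2 hs)

/-- The initial states of finite cost. -/
def finiteCostSubmodule (A : Matrix ι ι ℝ) {Q : Matrix ι ι ℝ} (hQ : Q.PosSemidef) :
    Submodule ℝ (ι → ℝ) where
  carrier := {x | flowCost A Q x < ⊤}
  zero_mem' := by simp [flowCost]
  add_mem' := by
    intro x y hx hy
    have hQ0 := (posSemidef_iff_isSymm.1 hQ).2
    have hle : flowCost A Q (x + y) ≤ 2 * flowCost A Q x + 2 * flowCost A Q y := by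
      simp only [flowCost]
      rw [← lintegral_const_mul' _ _ (by simp), ← lintegral_const_mul' _ _ (by simp),
        ← lintegral_add_left ((continuous_exp_quadratic A Q x).measurable.ennreal_ofReal.const_mul
          _)]
      refine lintegral_mono fun t => ?_
      have h2 : (2 : ENNReal) = ENNReal.ofReal 2 := by simp
      rw [h2, ← ENNReal.ofReal_mul (by norm_num), ← ENNReal.ofReal_mul (by norm_num),
        ← ENNReal.ofReal_add (by have := hQ0 (NormedSpace.exp (t • A) *ᵥ x); positivity)
          (by have := hQ0 (NormedSpace.exp (t • A) *ᵥ y); positivity), Matrix.mulVec_add]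
      exact ENNReal.ofReal_le_ofReal (quadratic_add_le hQ _ _)
    exact hle.trans_lt (ENNReal.add_lt_top.2
      ⟨ENNReal.mul_lt_top (by simp) hx, ENNReal.mul_lt_top (by simp) hy⟩)
  smul_mem' := by
    intro c x hx
    have : flowCost A Q (c • x) = ENNReal.ofReal (c ^ 2) * flowCost A Q x := by
      simp only [flowCost]
      rw [← lintegral_const_mul' _ _ (by simp)]
      refine lintegral_congr fun t => ?_
      rw [← ENNReal.ofReal_mul (by positivity)]
      simp only [Matrix.mulVec_smul, dotProduct_smul, smul_dotProduct, smul_eq_mul]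
      ring_nf
    simp only [Set.mem_ofPred_eq] at hx ⊢
    rw [this]
    exact ENNReal.mul_lt_top (by simp) hx

/-- `A x` is the limit of difference quotients of the flow at `0`, which lie in the closed subspace
`V`. -/
theorem mulVec_mem_of_exp_mulVec_mem {A : Matrix ι ι ℝ} {V : Submodule ℝ (ι → ℝ)} {x : ι → ℝ}
    (h : ∀ s : ℝ, 0 ≤ s → NormedSpace.exp (s • A) *ᵥ x ∈ V) : A *ᵥ x ∈ V := by
  have hd := (hasDerivAt_exp_mulVec A x 0).hasDerivWithinAt (s := Set.Ioi 0)
  rw [hasDerivWithinAt_iff_tendsto_slope' (by simp)] at hd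
  simp only [zero_smul, NormedSpace.exp_zero, Matrix.one_mulVec] at hd
  refine (Submodule.closed_of_finiteDimensional V).mem_of_tendsto hd ?_
  filter_upwards [self_mem_nhdsWithin] with s hs
  exact V.smul_mem _ (V.sub_mem (h s (le_of_lt hs)) (h 0 le_rfl))

theorem IsEigenpair.exp_mulVec {A : Matrix ι ι ℝ} {σ ω : ℝ} {a b : ι → ℝ}
    (h : IsEigenpair A σ ω a b) (t : ℝ) :
    IsEigenpair A σ ω (NormedSpace.exp (t • A) *ᵥ a) (NormedSpace.exp (t • A) *ᵥ b) := by
  have hc : ∀ x, A *ᵥ (NormedSpace.exp (t • A) *ᵥ x) = NormedSpace.exp (t • A) *ᵥ (A *ᵥ x) := by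
    intro x
    rw [Matrix.mulVec_mulVec, Matrix.mulVec_mulVec]
    congr 1
    exact (((Commute.refl A).smul_right t).exp_right).eq
  constructor
  · rw [hc, h.re, Matrix.mulVec_sub, Matrix.mulVec_smul, Matrix.mulVec_smul]
  · rw [hc, h.im, Matrix.mulVec_add, Matrix.mulVec_smul, Matrix.mulVec_smul]

/-- The weight `f`, summed over both parts of the eigenvector, satisfies `f' = 2σ f ≥ 0`. A
nonnegative nondecreasing function with finite integral over the half-line vanishes at `0`. -/
theorem IsEigenpair.weight_eq_zero_of_flowCost {A Q : Matrix ι ι ℝ} (hQ : Q.PosSemidef)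
    {σ ω : ℝ} (hσ : 0 ≤ σ) {a b : ι → ℝ} (h : IsEigenpair A σ ω a b)
    (ha : flowCost A Q a < ⊤) (hb : flowCost A Q b < ⊤) : Q *ᵥ a = 0 ∧ Q *ᵥ b = 0 := by
  have hQ0 := (posSemidef_iff_isSymm.1 hQ).2
  set f : ℝ → ℝ := fun t => (NormedSpace.exp (t • A) *ᵥ a) ⬝ᵥ
      (Q *ᵥ (NormedSpace.exp (t • A) *ᵥ a)) + (NormedSpace.exp (t • A) *ᵥ b) ⬝ᵥ
      (Q *ᵥ (NormedSpace.exp (t • A) *ᵥ b)) with hf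
  have hd : ∀ t, HasDerivAt f (2 * σ * f t) t := by
    intro t
    have := (hasDerivAt_exp_quadratic A Q a t).add (hasDerivAt_exp_quadratic A Q b t)
    rw [(h.exp_mulVec t).dotProduct_lyapunov hQ.isSymm_real] at this
    exact this
  have hf0 : ∀ t, 0 ≤ f t := fun t => add_nonneg (hQ0 _) (hQ0 _)
  have hmono : Monotone f := monotone_of_hasDerivAt_nonneg hd fun t => by
    have := hf0 t
    simp only [Pi.zero_apply]
    positivity
  have hsum : ∫⁻ t in Set.Ici (0 : ℝ), ENNReal.ofReal (f t) < ⊤ := by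
    simp only [hf]
    have := ENNReal.add_lt_top.2 ⟨ha, hb⟩
    rw [flowCost, flowCost, ← lintegral_add_left
      (continuous_exp_quadratic A Q a).measurable.ennreal_ofReal] at this
    refine (lintegral_mono fun t => ?_).trans_lt this
    rw [ENNReal.ofReal_add (hQ0 _) (hQ0 _)]
  have hle : ∫⁻ _ in Set.Ici (0 : ℝ), ENNReal.ofReal (f 0) ≤
      ∫⁻ t in Set.Ici (0 : ℝ), ENNReal.ofReal (f t) :=
    setLIntegral_mono' measurableSet_Ici fun t ht => ENNReal.ofReal_le_ofReal (hmono ht)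
  have h0 : f 0 ≤ 0 := by
    by_contra! hpos
    rw [setLIntegral_const, Real.volume_Ici, ENNReal.mul_top (by simpa using hpos)] at hle
    exact absurd hsum (not_lt.2 hle)
  simp only [hf, zero_smul, NormedSpace.exp_zero, Matrix.one_mulVec] at h0
  have h1 := hQ0 a
  have h2 := hQ0 b
  exact ⟨mulVec_eq_zero_of_posSemidef hQ (by linarith),
    mulVec_eq_zero_of_posSemidef hQ (by linarith)⟩

/-- Under detectability, a finite cost forces the trajectory to zero. -/
theorem tendsto_exp_mulVec_of_flowCost {A Q : Matrix ι ι ℝ} (hQ : Q.PosSemidef)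
    (hd : IsDetectable A Q) {x : ι → ℝ} (hx : flowCost A Q x < ⊤) :
    Tendsto (fun t : ℝ => NormedSpace.exp (t • A) *ᵥ x) atTop (𝓝 0) := by
  -- States of finite cost form a subspace invariant under the flow, hence under `A`. Unstable
  -- eigenvectors inside it carry no weight, and detectability excludes them.
  refine tendsto_exp_mulVec A (finiteCostSubmodule A hQ) ?_ ?_ x hx
  · intro y hy
    exact mulVec_mem_of_exp_mulVec_mem fun s hs => (flowCost_exp_le A Q y hs).trans_lt hy
  · intro σ ω a ha b hb hσ hab
    obtain ⟨h1, h2⟩ := hab.weight_eq_zero_of_flowCost hQ hσ ha hb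
    exact hd σ ω a b hσ hab h1 h2

theorem isHurwitz_of_flowCost {A Q : Matrix ι ι ℝ} (hQ : Q.PosSemidef)
    (hd : IsDetectable A Q) (h : ∀ x, flowCost A Q x < ⊤) : IsHurwitz A := by
  rw [isHurwitz_iff]
  intro σ ω a b hσ hab
  obtain ⟨h1, h2⟩ := hab.weight_eq_zero_of_flowCost hQ hσ (h a) (h b)
  exact hd σ ω a b hσ hab h1 h2

/-- A detectable pair whose Lyapunov equation has a positive semidefinite solution is Hurwitz. -/
theorem isHurwitz_of_lyapunov {A P Q : Matrix ι ι ℝ} (hQ : Q.PosSemidef)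
    (hd : IsDetectable A Q) (hP : P.PosSemidef) (hl : Aᵀ * P + P * A + Q = 0) : IsHurwitz A := by
  rw [isHurwitz_iff]
  intro σ ω a b hσ hab
  obtain ⟨h1, h2⟩ := hab.weight_eq_zero hP hQ hl hσ
  exact hd σ ω a b hσ hab h1 h2

theorem lyapunov_unique {A P P' Q : Matrix ι ι ℝ} (hA : IsHurwitz A)
    (hP : Aᵀ * P + P * A + Q = 0) (hP' : Aᵀ * P' + P' * A + Q = 0) : P = P' := by
  rw [← sub_eq_zero]
  apply sylvester_eq_zero hA hA
  rw [mul_sub, sub_mul, ← sub_eq_zero.2 (hP.trans hP'.symm)]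
  abel

/-- The Lyapunov operator is injective on a finite-dimensional space, hence surjective. -/
theorem lyapunov_exists {A : Matrix ι ι ℝ} (hA : IsHurwitz A) (Q : Matrix ι ι ℝ) :
    ∃ P, Aᵀ * P + P * A + Q = 0 := by
  let f : Matrix ι ι ℝ →ₗ[ℝ] Matrix ι ι ℝ := LinearMap.mulLeft ℝ Aᵀ + LinearMap.mulRight ℝ A
  have hf : Function.Injective f := (injective_iff_map_eq_zero f).2 fun X hX =>
    sylvester_eq_zero hA hA hX
  obtain ⟨P, hP⟩ := LinearMap.injective_iff_surjective.1 hf (-Q)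
  exact ⟨P, by rw [← neg_neg Q, ← hP]; exact add_neg_cancel _⟩

/-- Symmetry follows from uniqueness, since `Pᵀ` solves the same equation; the form is nonnegative
because it is a cost. -/
theorem lyapunov_posSemidef {A P Q : Matrix ι ι ℝ} (hA : IsHurwitz A) (hQ : Q.PosSemidef)
    (hl : Aᵀ * P + P * A + Q = 0) : P.PosSemidef := by
  rw [posSemidef_iff_isSymm]
  refine ⟨?_, fun x => (flowCost_eq hQ hl (hA.tendsto_exp_mulVec x)).1⟩
  refine lyapunov_unique (Q := Q) hA ?_ hl
  have := congrArg Matrix.transpose hl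
  simp only [Matrix.transpose_add, Matrix.transpose_mul, Matrix.transpose_transpose,
    Matrix.transpose_zero, hQ.isSymm_real.eq] at this
  rw [← this]
  abel

end Cost

/-! ### The Riccati equation, optimal gains and policy iteration -/

section Regulator

open Filter Topology

variable {ι κ : Type*} [Fintype ι] [Fintype κ]

theorem posSemidef_feedback_weight {Q : Matrix ι ι ℝ} {R : Matrix κ κ ℝ} (hQ : Q.PosSemidef)
    (hR : R.PosDef) (K : Matrix κ ι ℝ) : (Q + Kᵀ * R * K).PosSemidef :=
  hQ.add (posSemidef_transpose_mul_mul hR.posSemidef K)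

variable [DecidableEq κ]

/-- As `R` is definite, a vector without weight satisfies `K x = 0`, and open and closed loop agree
on it. -/
theorem IsDetectable.feedback {A Q : Matrix ι ι ℝ} {R : Matrix κ κ ℝ} (hQ : Q.PosSemidef)
    (hR : R.PosDef) (hd : IsDetectable A Q) (B : Matrix ι κ ℝ) (K : Matrix κ ι ℝ) :
    IsDetectable (A - B * K) (Q + Kᵀ * R * K) := by
  intro σ ω a b hσ hab ha hb
  obtain ⟨ha1, ha2⟩ := mulVec_eq_zero_of_add_mulVec_eq_zero hQ
    (posSemidef_transpose_mul_mul hR.posSemidef K) ha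
  obtain ⟨hb1, hb2⟩ := mulVec_eq_zero_of_add_mulVec_eq_zero hQ
    (posSemidef_transpose_mul_mul hR.posSemidef K) hb
  refine hd σ ω a b hσ ⟨?_, ?_⟩ ha1 hb1
  · rw [← hab.re, Matrix.sub_mulVec, ← Matrix.mulVec_mulVec, mulVec_eq_zero_of_posDef hR ha2,
      Matrix.mulVec_zero, sub_zero]
  · rw [← hab.im, Matrix.sub_mulVec, ← Matrix.mulVec_mulVec, mulVec_eq_zero_of_posDef hR hb2,
      Matrix.mulVec_zero, sub_zero]

/-- Completion of the square. -/
theorem lyapunov_feedback {A P Q : Matrix ι ι ℝ} {B : Matrix ι κ ℝ} {R : Matrix κ κ ℝ}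
    (hP : P.IsSymm) (hR : R.PosDef) (K : Matrix κ ι ℝ) :
    (A - B * K)ᵀ * P + P * (A - B * K) + (Q + Kᵀ * R * K) =
      Aᵀ * P + P * A + Q - P * B * R⁻¹ * Bᵀ * P +
        (K - R⁻¹ * Bᵀ * P)ᵀ * R * (K - R⁻¹ * Bᵀ * P) := by
  have hdet : IsUnit R.det := (Matrix.isUnit_iff_isUnit_det _).1 hR.isUnit
  have hRs := hR.posSemidef.isSymm_real.eq
  have hRi : (R⁻¹)ᵀ = R⁻¹ := by rw [Matrix.transpose_nonsing_inv, hRs]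
  have h1 : R * (R⁻¹ * (Bᵀ * P)) = Bᵀ * P := by
    rw [← Matrix.mul_assoc, Matrix.mul_nonsing_inv _ hdet, Matrix.one_mul]
  have h2 : P * (B * (R⁻¹ * (R * K))) = P * (B * K) := by
    rw [← Matrix.mul_assoc R⁻¹, Matrix.nonsing_inv_mul _ hdet, Matrix.one_mul]
  simp only [Matrix.transpose_sub, Matrix.transpose_mul, Matrix.transpose_transpose, hRi, hP.eq,
    Matrix.sub_mul, Matrix.mul_sub, Matrix.mul_assoc, h1, h2]
  abel

theorem feedback_eq_of_isRiccati {A P Q : Matrix ι ι ℝ} {B : Matrix ι κ ℝ} {R : Matrix κ κ ℝ}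
    (hP : P.IsSymm) (hR : R.PosDef) (hr : Aᵀ * P + P * A + Q - P * B * R⁻¹ * Bᵀ * P = 0)
    (K : Matrix κ ι ℝ) :
    (A - B * K)ᵀ * P + P * (A - B * K) + (Q + Kᵀ * R * K) =
      (K - R⁻¹ * Bᵀ * P)ᵀ * R * (K - R⁻¹ * Bᵀ * P) := by
  rw [lyapunov_feedback hP hR, hr, zero_add]

/-- Each quadratic form decreases and is bounded below by zero; polarization recovers the matrix
entries from the forms. -/
theorem tendsto_of_antitone_posSemidef {P : ℕ → Matrix ι ι ℝ} (hP : ∀ i, (P i).PosSemidef)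
    (hanti : ∀ i, (P i - P (i + 1)).PosSemidef) : ∃ P', Tendsto P atTop (𝓝 P') := by
  classical
  have hx : ∀ x : ι → ℝ, ∃ l, Tendsto (fun i => x ⬝ᵥ (P i *ᵥ x)) atTop (𝓝 l) := by
    intro x
    refine ⟨_, tendsto_atTop_ciInf (antitone_nat_of_succ_le fun i => ?_)
      ⟨0, Set.forall_mem_range.2 fun i => (posSemidef_iff_isSymm.1 (hP i)).2 x⟩⟩
    have := (posSemidef_iff_isSymm.1 (hanti i)).2 x
    rw [Matrix.sub_mulVec, dotProduct_sub] at this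
    linarith
  choose l hl using hx
  refine ⟨Matrix.of fun i j => (l (Pi.single i 1 + Pi.single j 1) -
    l (Pi.single i 1 - Pi.single j 1)) / 4, ?_⟩
  refine tendsto_pi_nhds.2 fun i => tendsto_pi_nhds.2 fun j => ?_
  refine (((hl (Pi.single i 1 + Pi.single j 1)).sub
    (hl (Pi.single i 1 - Pi.single j 1))).div_const 4).congr fun k => ?_
  have h := dotProduct_mulVec_comm_of_isSymm (hP k).isSymm_real (Pi.single i 1) (Pi.single j 1)
  have h2 : (Pi.single i (1 : ℝ) : ι → ℝ) ⬝ᵥ (P k *ᵥ Pi.single j 1) = P k i j := by simp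
  simp only [Matrix.mulVec_add, Matrix.mulVec_sub, dotProduct_add, dotProduct_sub, add_dotProduct,
    sub_dotProduct, ← h, h2]
  ring

variable [DecidableEq ι]

/-- Policy improvement keeps the closed loop stable. -/
theorem isHurwitz_improvement {A P Q : Matrix ι ι ℝ} {B : Matrix ι κ ℝ} {R : Matrix κ κ ℝ}
    {K : Matrix κ ι ℝ} (hQ : Q.PosSemidef) (hR : R.PosDef) (hK : IsHurwitz (A - B * K))
    (hP : P.PosSemidef)
    (hl : (A - B * K)ᵀ * P + P * (A - B * K) + (Q + Kᵀ * R * K) = 0) :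
    IsHurwitz (A - B * (R⁻¹ * Bᵀ * P)) := by
  set K' := R⁻¹ * Bᵀ * P with hK'
  have hD := posSemidef_transpose_mul_mul hR.posSemidef (K - K')
  -- Completing the square for `K` and for `K'` shows that `P` also solves a Lyapunov equation of
  -- the new loop, with the additional weight `(K - K')ᵀ R (K - K')`.
  have hl' : (A - B * K')ᵀ * P + P * (A - B * K') +
      ((Q + K'ᵀ * R * K') + (K - K')ᵀ * R * (K - K')) = 0 := by
    have h1 := lyapunov_feedback (A := A) (Q := Q) (B := B) hP.isSymm_real hR K
    have h2 := lyapunov_feedback (A := A) (Q := Q) (B := B) hP.isSymm_real hR K'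
    rw [← hK', hl] at h1
    rw [← hK', sub_self, Matrix.mul_zero, add_zero] at h2
    rw [← add_assoc, h2, ← h1]
  rw [isHurwitz_iff] at hK ⊢
  intro σ ω a b hσ hab
  have hQ' := posSemidef_feedback_weight hQ hR K'
  obtain ⟨h1, h2⟩ := hab.weight_eq_zero hP (hQ'.add hD) hl' hσ
  -- Unstable eigenvectors of the new loop are killed by `K - K'`, so they would be unstable
  -- eigenvectors of the old loop too.
  have heq : ∀ x, (K - K') *ᵥ x = 0 → (A - B * K) *ᵥ x = (A - B * K') *ᵥ x := by
    intro x hx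
    rw [Matrix.sub_mulVec, sub_eq_zero] at hx
    simp only [Matrix.sub_mulVec, ← Matrix.mulVec_mulVec, hx]
  have h3 := mulVec_eq_zero_of_posDef hR (mulVec_eq_zero_of_add_mulVec_eq_zero hQ' hD h1).2
  have h4 := mulVec_eq_zero_of_posDef hR (mulVec_eq_zero_of_add_mulVec_eq_zero hQ' hD h2).2
  exact hK σ ω a b hσ ⟨(heq a h3).trans hab.re, (heq b h4).trans hab.im⟩

/-- Policy improvement decreases the cost. -/
theorem posSemidef_sub_improvement {A P P' Q : Matrix ι ι ℝ} {B : Matrix ι κ ℝ}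
    {R : Matrix κ κ ℝ} {K : Matrix κ ι ℝ} (hR : R.PosDef)
    (hP : P.PosSemidef)
    (hl : (A - B * K)ᵀ * P + P * (A - B * K) + (Q + Kᵀ * R * K) = 0)
    (hK' : IsHurwitz (A - B * (R⁻¹ * Bᵀ * P)))
    (hl' : (A - B * (R⁻¹ * Bᵀ * P))ᵀ * P' + P' * (A - B * (R⁻¹ * Bᵀ * P)) +
      (Q + (R⁻¹ * Bᵀ * P)ᵀ * R * (R⁻¹ * Bᵀ * P)) = 0) :
    (P - P').PosSemidef := by
  set K' := R⁻¹ * Bᵀ * P with hK'_def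
  -- `P - P'` solves the Lyapunov equation of the new loop with weight `(K - K')ᵀ R (K - K')`.
  refine lyapunov_posSemidef hK' (posSemidef_transpose_mul_mul hR.posSemidef (K - K')) ?_
  have h1 := lyapunov_feedback (A := A) (Q := Q) (B := B) hP.isSymm_real hR K
  have h2 := lyapunov_feedback (A := A) (Q := Q) (B := B) hP.isSymm_real hR K'
  rw [← hK'_def, hl] at h1
  rw [← hK'_def, sub_self, Matrix.mul_zero, add_zero] at h2
  rw [← h2, ← sub_eq_zero.2 hl'] at h1
  rw [mul_sub, sub_mul]
  rw [← sub_eq_zero] at h1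
  rw [← neg_eq_zero, ← h1]
  abel

/-- For `K = R⁻¹ Bᵀ P` the square vanishes, and the Riccati equation is the Lyapunov equation of the
closed loop. -/
theorem isHurwitz_of_isRiccatiSolution {N m : ℕ} {A Q P : Matrix (Fin N) (Fin N) ℝ}
    {B : Matrix (Fin N) (Fin m) ℝ} {R : Matrix (Fin m) (Fin m) ℝ} (hQ : Q.PosSemidef)
    (hR : R.PosDef) (hd : IsDetectable A Q) (h : IsRiccatiSolution A B Q R P) :
    IsHurwitz (A - B * (R⁻¹ * Bᵀ * P)) := by
  refine isHurwitz_of_lyapunov (posSemidef_feedback_weight hQ hR _) (hd.feedback hQ hR B _) h.1 ?_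
  rw [feedback_eq_of_isRiccati h.1.isSymm_real hR h.2, sub_self, Matrix.mul_zero]

/-- Subtracting the equations gives `(A - B K)ᵀ X + X (A - B K') = 0` for `X = P - P'`, a Sylvester
equation with two different Hurwitz closed loops. -/
theorem IsRiccatiSolution.unique {N m : ℕ} {A Q P P' : Matrix (Fin N) (Fin N) ℝ}
    {B : Matrix (Fin N) (Fin m) ℝ} {R : Matrix (Fin m) (Fin m) ℝ} (hQ : Q.PosSemidef)
    (hR : R.PosDef) (hd : IsDetectable A Q) (h : IsRiccatiSolution A B Q R P)
    (h' : IsRiccatiSolution A B Q R P') : P = P' := by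
  rw [← sub_eq_zero]
  refine sylvester_eq_zero (isHurwitz_of_isRiccatiSolution hQ hR hd h)
    (isHurwitz_of_isRiccatiSolution hQ hR hd h') ?_
  have hRi : (R⁻¹)ᵀ = R⁻¹ := by
    rw [Matrix.transpose_nonsing_inv, hR.posSemidef.isSymm_real.eq]
  have h1 := h.2.trans h'.2.symm
  rw [← sub_eq_zero] at h1
  rw [← h1]
  simp only [Matrix.transpose_sub, Matrix.transpose_mul, Matrix.transpose_transpose, hRi,
    h.1.isSymm_real.eq, Matrix.sub_mul, Matrix.mul_sub, Matrix.mul_assoc]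
  abel

theorem feedbackCost_eq_flowCost {N m : ℕ} (A Q : Matrix (Fin N) (Fin N) ℝ)
    (B : Matrix (Fin N) (Fin m) ℝ) (R : Matrix (Fin m) (Fin m) ℝ) (x : Fin N → ℝ)
    (K : Matrix (Fin m) (Fin N) ℝ) :
    feedbackCost A B Q R x K = flowCost (A - B * K) (Q + Kᵀ * R * K) x := by
  simp only [feedbackCost, flowCost, Matrix.add_mulVec, dotProduct_add,
    dotProduct_transpose_mul_mul, Matrix.mulVec_neg, dotProduct_neg, neg_dotProduct, neg_neg]

section Riccati

variable {N m : ℕ} {A Q P : Matrix (Fin N) (Fin N) ℝ} {B : Matrix (Fin N) (Fin m) ℝ}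
  {R : Matrix (Fin m) (Fin m) ℝ}

theorem IsRiccatiSolution.feedbackCost_eq (h : IsRiccatiSolution A B Q R P) (hQ : Q.PosSemidef)
    (hR : R.PosDef) (hd : IsDetectable A Q) (x : Fin N → ℝ) :
    feedbackCost A B Q R x (R⁻¹ * Bᵀ * P) = ENNReal.ofReal (x ⬝ᵥ (P *ᵥ x)) := by
  rw [feedbackCost_eq_flowCost]
  refine (flowCost_eq (posSemidef_feedback_weight hQ hR _) ?_
    ((isHurwitz_of_isRiccatiSolution hQ hR hd h).tendsto_exp_mulVec x)).2
  rw [feedback_eq_of_isRiccati h.1.isSymm_real hR h.2, sub_self, Matrix.mul_zero]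

/-- The gain need not be stabilizing: a finite cost already drives this trajectory to zero, which is
all the comparison uses. -/
theorem IsRiccatiSolution.le_feedbackCost (h : IsRiccatiSolution A B Q R P) (hQ : Q.PosSemidef)
    (hR : R.PosDef) (hd : IsDetectable A Q) (x : Fin N → ℝ) (K : Matrix (Fin m) (Fin N) ℝ) :
    ENNReal.ofReal (x ⬝ᵥ (P *ᵥ x)) ≤ feedbackCost A B Q R x K := by
  rw [feedbackCost_eq_flowCost]
  rcases eq_or_ne (flowCost (A - B * K) (Q + Kᵀ * R * K) x) ⊤ with htop | htop
  · rw [htop]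
    exact le_top
  · have hw := posSemidef_feedback_weight hQ hR K
    refine le_flowCost hw ?_ (tendsto_exp_mulVec_of_flowCost hw (hd.feedback hQ hR B K)
      (lt_top_iff_ne_top.2 htop))
    rw [feedback_eq_of_isRiccati h.1.isSymm_real hR h.2]
    exact posSemidef_transpose_mul_mul hR.posSemidef _

theorem eq_of_quadratic_eq {P P' : Matrix ι ι ℝ} (hP : P.IsSymm) (hP' : P'.IsSymm)
    (h : ∀ x : ι → ℝ, x ⬝ᵥ (P *ᵥ x) = x ⬝ᵥ (P' *ᵥ x)) : P = P' := by
  ext i j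
  have h1 := h (Pi.single i 1 + Pi.single j 1)
  have h2 := dotProduct_mulVec_comm_of_isSymm hP (Pi.single i 1) (Pi.single j 1)
  have h3 := dotProduct_mulVec_comm_of_isSymm hP' (Pi.single i 1) (Pi.single j 1)
  have h4 : ∀ M : Matrix ι ι ℝ,
      (Pi.single i (1 : ℝ) : ι → ℝ) ⬝ᵥ (M *ᵥ Pi.single j 1) = M i j := by simp
  simp only [Matrix.mulVec_add, dotProduct_add, add_dotProduct, h, ← h2, ← h3, h4] at h1
  linarith

/-- An optimal gain has finite cost everywhere, so it is stabilizing, and its Lyapunov solution has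
the same quadratic form as `P`. The two matrices agree, the square vanishes, and definiteness of `R`
fixes the gain. -/
theorem IsRiccatiSolution.isOptimalGain_iff (h : IsRiccatiSolution A B Q R P)
    (hQ : Q.PosSemidef) (hR : R.PosDef) (hd : IsDetectable A Q) (K : Matrix (Fin m) (Fin N) ℝ) :
    IsOptimalGain A B Q R K ↔ K = R⁻¹ * Bᵀ * P := by
  constructor
  · intro hK
    have hw := posSemidef_feedback_weight hQ hR K
    have hcost : ∀ x, flowCost (A - B * K) (Q + Kᵀ * R * K) x =
        ENNReal.ofReal (x ⬝ᵥ (P *ᵥ x)) := by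
      intro x
      rw [← feedbackCost_eq_flowCost]
      refine le_antisymm ?_ (h.le_feedbackCost hQ hR hd x K)
      rw [← h.feedbackCost_eq hQ hR hd x]
      exact hK x _
    have hH : IsHurwitz (A - B * K) := isHurwitz_of_flowCost hw (hd.feedback hQ hR B K)
      fun x => by rw [hcost]; exact ENNReal.ofReal_lt_top
    obtain ⟨P', hP'⟩ := lyapunov_exists hH (Q + Kᵀ * R * K)
    have hP'0 := lyapunov_posSemidef hH hw hP'
    have heq : P = P' := by
      refine eq_of_quadratic_eq h.1.isSymm_real hP'0.isSymm_real fun x => ?_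
      obtain ⟨h1, h2⟩ := flowCost_eq hw hP' (hH.tendsto_exp_mulVec x)
      rw [hcost, ENNReal.ofReal_eq_ofReal_iff ((posSemidef_iff_isSymm.1 h.1).2 x) h1] at h2
      exact h2
    rw [← heq, feedback_eq_of_isRiccati h.1.isSymm_real hR h.2] at hP'
    rw [← sub_eq_zero]
    refine Matrix.toLin'.injective (LinearMap.ext fun x => ?_)
    rw [Matrix.toLin'_apply, map_zero, LinearMap.zero_apply]
    exact mulVec_eq_zero_of_posDef hR (by rw [hP', Matrix.zero_mulVec])
  · rintro rfl x K'
    rw [h.feedbackCost_eq hQ hR hd]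
    exact h.le_feedbackCost hQ hR hd x K'

end Riccati

/-- Convergence of a policy iteration whose evaluation step solves a Lyapunov equation. -/
theorem policyIteration_convergence {N m p T : ℕ} {A Q' : Matrix (Fin N) (Fin N) ℝ}
    {B : Matrix (Fin N) (Fin m) ℝ} {R : Matrix (Fin m) (Fin m) ℝ}
    {Φ₀ Φ₁ : Matrix (Fin N) (Fin T) ℝ} {U₀ : Matrix (Fin m) (Fin T) ℝ}
    {Y₀ : Matrix (Fin p) (Fin T) ℝ} {Q : Matrix (Fin p) (Fin p) ℝ}
    {K₀ : Matrix (Fin m) (Fin N) ℝ} (hQ : Q'.PosSemidef) (hR : R.PosDef)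
    (hd : IsDetectable A Q')
    (hE : ∀ K P, PolicyEvaluation Φ₀ Φ₁ U₀ Y₀ B Q R K P ↔
      (A - B * K)ᵀ * P + P * (A - B * K) + (Q' + Kᵀ * R * K) = 0)
    (hK₀ : IsHurwitz (A - B * K₀)) :
    (∃ P K, IsPolicyIteration Φ₀ Φ₁ U₀ Y₀ B Q R K₀ P K) ∧
    ∃ (Pstar : Matrix (Fin N) (Fin N) ℝ) (Kstar : Matrix (Fin m) (Fin N) ℝ),
      (∀ P', IsRiccatiSolution A B Q' R P' ↔ P' = Pstar) ∧
      Kstar = R⁻¹ * Bᵀ * Pstar ∧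
      IsHurwitz (A - B * Kstar) ∧
      (∀ K', IsOptimalGain A B Q' R K' ↔ K' = Kstar) ∧
      (∀ φ₀, feedbackCost A B Q' R φ₀ Kstar = ENNReal.ofReal (φ₀ ⬝ᵥ (Pstar *ᵥ φ₀))) ∧
      ∀ P K, IsPolicyIteration Φ₀ Φ₁ U₀ Y₀ B Q R K₀ P K →
        (∀ i P', PolicyEvaluation Φ₀ Φ₁ U₀ Y₀ B Q R (K i) P' → P' = P i) ∧
        (∀ i, IsHurwitz (A - B * K i)) ∧
        (∀ i, (P i).PosSemidef) ∧
        (∀ i, (P i - P (i + 1)).PosSemidef) ∧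
        Tendsto P atTop (𝓝 Pstar) ∧ Tendsto K atTop (𝓝 Kstar) := by
  have hex : ∃ P K, IsPolicyIteration Φ₀ Φ₁ U₀ Y₀ B Q R K₀ P K := by
    classical
    -- The default value `0` is never reached, since all gains of the run are stabilizing.
    let ev : Matrix (Fin m) (Fin N) ℝ → Matrix (Fin N) (Fin N) ℝ := fun K =>
      if h : ∃ P, PolicyEvaluation Φ₀ Φ₁ U₀ Y₀ B Q R K P then h.choose else 0
    have hev : ∀ K, IsHurwitz (A - B * K) → PolicyEvaluation Φ₀ Φ₁ U₀ Y₀ B Q R K (ev K) := by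
      intro K hK
      obtain ⟨P, hP⟩ := lyapunov_exists hK (Q' + Kᵀ * R * K)
      have h : ∃ P, PolicyEvaluation Φ₀ Φ₁ U₀ Y₀ B Q R K P := ⟨P, (hE K P).2 hP⟩
      simp only [ev, dif_pos h]
      exact h.choose_spec
    let K : ℕ → Matrix (Fin m) (Fin N) ℝ := fun i =>
      Nat.rec K₀ (fun _ K => R⁻¹ * Bᵀ * ev K) i
    have hK : ∀ i, IsHurwitz (A - B * K i) := by
      intro i
      induction i with
      | zero => exact hK₀
      | succ i ih =>
        have hl := (hE _ _).1 (hev _ ih)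
        exact isHurwitz_improvement hQ hR ih
          (lyapunov_posSemidef ih (posSemidef_feedback_weight hQ hR _) hl) hl
    exact ⟨fun i => ev (K i), K, rfl, fun i => hev _ (hK i), fun i => rfl⟩
  have hrun : ∀ P K, IsPolicyIteration Φ₀ Φ₁ U₀ Y₀ B Q R K₀ P K →
      (∀ i, IsHurwitz (A - B * K i)) ∧ (∀ i, (P i).PosSemidef) ∧
      (∀ i, (P i - P (i + 1)).PosSemidef) ∧
      ∃ P', IsRiccatiSolution A B Q' R P' ∧ Tendsto P atTop (𝓝 P') ∧
        Tendsto K atTop (𝓝 (R⁻¹ * Bᵀ * P')) := by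
    intro P K h
    have hl := fun i => (hE _ _).1 (h.evaluation i)
    have hP : ∀ i, IsHurwitz (A - B * K i) → (P i).PosSemidef := fun i hi =>
      lyapunov_posSemidef hi (posSemidef_feedback_weight hQ hR _) (hl i)
    have hK : ∀ i, IsHurwitz (A - B * K i) := by
      intro i
      induction i with
      | zero => rw [h.init]; exact hK₀
      | succ i ih =>
        rw [h.improvement]
        exact isHurwitz_improvement hQ hR ih (hP i ih) (hl i)
    have hanti : ∀ i, (P i - P (i + 1)).PosSemidef := by
      intro i
      have h1 := hK (i + 1)
      have h2 := hl (i + 1)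
      rw [h.improvement] at h1 h2
      exact posSemidef_sub_improvement hR (hP i (hK i)) (hl i) h1 h2
    obtain ⟨P', hP'⟩ := tendsto_of_antitone_posSemidef (fun i => hP i (hK i)) hanti
    have hK' : Tendsto K atTop (𝓝 (R⁻¹ * Bᵀ * P')) := by
      rw [← tendsto_add_atTop_iff_nat 1]
      simp only [h.improvement]
      have hc : Continuous fun X : Matrix (Fin N) (Fin N) ℝ => R⁻¹ * Bᵀ * X := by fun_prop
      exact (hc.tendsto P').comp hP'
    have hpsd : P'.PosSemidef := by
      rw [posSemidef_iff_isSymm]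
      constructor
      · have hc : Continuous fun X : Matrix (Fin N) (Fin N) ℝ => Xᵀ := by fun_prop
        refine tendsto_nhds_unique ((hc.tendsto P').comp hP') (hP'.congr fun i => ?_)
        exact (hP i (hK i)).isSymm_real.eq.symm
      · intro x
        have hc : Continuous fun X : Matrix (Fin N) (Fin N) ℝ => x ⬝ᵥ (X *ᵥ x) := by fun_prop
        exact ge_of_tendsto' ((hc.tendsto P').comp hP') fun i =>
          (posSemidef_iff_isSymm.1 (hP i (hK i))).2 x
    refine ⟨hK, fun i => hP i (hK i), hanti, P', ⟨hpsd, ?_⟩, hP', hK'⟩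
    -- In the limit the Lyapunov equation holds with the gain `R⁻¹ Bᵀ P'`, for which the square
    -- vanishes; this is the Riccati equation.
    have hc : Continuous fun X : Matrix (Fin m) (Fin N) ℝ × Matrix (Fin N) (Fin N) ℝ =>
        (A - B * X.1)ᵀ * X.2 + X.2 * (A - B * X.1) + (Q' + X.1ᵀ * R * X.1) := by fun_prop
    have hlim := tendsto_nhds_unique ((hc.tendsto (R⁻¹ * Bᵀ * P', P')).comp
      (hK'.prodMk_nhds hP')) (tendsto_const_nhds.congr fun i => (hl i).symm)
    simp only at hlim
    rw [lyapunov_feedback hpsd.isSymm_real hR, sub_self, Matrix.mul_zero, add_zero] at hlim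
    exact hlim
  refine ⟨hex, ?_⟩
  -- Existence of a Riccati solution is read off from the limit of one run.
  obtain ⟨P₀, K₁, h₀⟩ := hex
  obtain ⟨-, -, -, Pstar, hstar, -, -⟩ := hrun P₀ K₁ h₀
  refine ⟨Pstar, R⁻¹ * Bᵀ * Pstar, fun P' => ⟨fun h => h.unique hQ hR hd hstar, ?_⟩, rfl,
    isHurwitz_of_isRiccatiSolution hQ hR hd hstar, hstar.isOptimalGain_iff hQ hR hd,
    hstar.feedbackCost_eq hQ hR hd, ?_⟩
  · rintro rfl
    exact hstar
  · intro P K h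
    obtain ⟨hK, hP, hanti, P', hP', hlim, hlimK⟩ := hrun P K h
    obtain rfl := hP'.unique hQ hR hd hstar
    refine ⟨fun i X hX => ?_, hK, hP, hanti, hlim, hlimK⟩
    exact lyapunov_unique (hK i) ((hE _ _).1 hX) ((hE _ _).1 (h.evaluation i))

end Regulator

/-! ### Coefficients of the adjugate of the characteristic matrix -/

section AdjugateCoefficients

variable {n : ℕ} (N : Matrix (Fin n) (Fin n) ℝ)

theorem charmatrix_mul (Z : Matrix (Fin n) (Fin n) (Polynomial ℝ)) :
    N.charmatrix * Z = (Polynomial.X : Polynomial ℝ) • Z - N.map Polynomial.C * Z := by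
  rw [Matrix.charmatrix, Matrix.sub_mul, Matrix.scalar_apply, Matrix.smul_eq_diagonal_mul]
  rfl

theorem mul_charmatrix (Z : Matrix (Fin n) (Fin n) (Polynomial ℝ)) :
    Z * N.charmatrix = (Polynomial.X : Polynomial ℝ) • Z - Z * N.map Polynomial.C := by
  rw [Matrix.charmatrix, Matrix.mul_sub, Matrix.scalar_apply, ← Matrix.op_smul_eq_mul_diagonal]
  congr 1
  ext i j : 2
  simp [mul_comm]

theorem coeff_charmatrix_mul (Z : Matrix (Fin n) (Fin n) (Polynomial ℝ)) (k : ℕ) :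
    (N.charmatrix * Z).map (fun q => q.coeff (k + 1)) =
      Z.map (fun q => q.coeff k) - N * Z.map (fun q => q.coeff (k + 1)) := by
  rw [charmatrix_mul]
  ext i j
  simp [Matrix.mul_apply]

theorem coeff_zero_charmatrix_mul (Z : Matrix (Fin n) (Fin n) (Polynomial ℝ)) :
    (N.charmatrix * Z).map (fun q => q.coeff 0) = -(N * Z.map (fun q => q.coeff 0)) := by
  rw [charmatrix_mul]
  ext i j
  simp [Matrix.mul_apply]

theorem coeff_mul_charmatrix (Z : Matrix (Fin n) (Fin n) (Polynomial ℝ)) (k : ℕ) :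
    (Z * N.charmatrix).map (fun q => q.coeff (k + 1)) =
      Z.map (fun q => q.coeff k) - Z.map (fun q => q.coeff (k + 1)) * N := by
  rw [mul_charmatrix]
  ext i j
  simp [Matrix.mul_apply]

theorem coeff_zero_mul_charmatrix (Z : Matrix (Fin n) (Fin n) (Polynomial ℝ)) :
    (Z * N.charmatrix).map (fun q => q.coeff 0) = -(Z.map (fun q => q.coeff 0) * N) := by
  rw [mul_charmatrix]
  ext i j
  simp [Matrix.mul_apply]

theorem coeff_charpoly_smul_one (k : ℕ) :
    (N.charpoly • (1 : Matrix (Fin n) (Fin n) (Polynomial ℝ))).map (fun q => q.coeff k) =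
      N.charpoly.coeff k • (1 : Matrix (Fin n) (Fin n) ℝ) := by
  ext i j
  by_cases h : i = j <;> simp [h]

/-- Compare coefficients in `(s I - N) adj (s I - N) = det (s I - N) I`; the product in the other
order gives `adjCoeff_succ_mul`. -/
theorem mul_adjCoeff_succ (k : ℕ) :
    N * adjCoeff N (k + 1) = adjCoeff N k - N.charpoly.coeff (k + 1) • 1 := by
  rw [← coeff_charpoly_smul_one, Matrix.charpoly, ← Matrix.mul_adjugate, coeff_charmatrix_mul]
  simp [adjCoeff]

theorem mul_adjCoeff_zero : N * adjCoeff N 0 = -(N.charpoly.coeff 0 • 1) := by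
  rw [← coeff_charpoly_smul_one, Matrix.charpoly, ← Matrix.mul_adjugate,
    coeff_zero_charmatrix_mul]
  simp [adjCoeff]

theorem adjCoeff_succ_mul (k : ℕ) :
    adjCoeff N (k + 1) * N = adjCoeff N k - N.charpoly.coeff (k + 1) • 1 := by
  rw [← coeff_charpoly_smul_one, Matrix.charpoly, ← Matrix.adjugate_mul, coeff_mul_charmatrix]
  simp [adjCoeff]

theorem adjCoeff_zero_mul : adjCoeff N 0 * N = -(N.charpoly.coeff 0 • 1) := by
  rw [← coeff_charpoly_smul_one, Matrix.charpoly, ← Matrix.adjugate_mul,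
    coeff_zero_mul_charmatrix]
  simp [adjCoeff]

/-- From index `n` on the recursion reads `D_j = N D_{j+1}`. Since `D_j` vanishes for large `j`, it
vanishes back down to `n`. -/
theorem adjCoeff_eq_zero {k : ℕ} (hk : n ≤ k) : adjCoeff N k = 0 := by
  have hstep : ∀ j, n ≤ j → adjCoeff N j = N * adjCoeff N (j + 1) := by
    intro j hj
    rw [mul_adjCoeff_succ, Polynomial.coeff_eq_zero_of_natDegree_lt, zero_smul, sub_zero]
    rw [Matrix.charpoly_natDegree_eq_dim, Fintype.card_fin]
    lia
  have hpow : ∀ l, adjCoeff N k = N ^ l * adjCoeff N (k + l) := by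
    intro l
    induction l with
    | zero => simp
    | succ l ih => rw [ih, hstep (k + l) (by lia), pow_succ, Matrix.mul_assoc, add_assoc]
  let d := Finset.univ.sup fun i => Finset.univ.sup fun j => (N.charmatrix.adjugate i j).natDegree
  have h0 : adjCoeff N (k + (d + 1)) = 0 := by
    ext i j
    refine Polynomial.coeff_eq_zero_of_natDegree_lt ?_
    have h1 : (N.charmatrix.adjugate i j).natDegree ≤ d :=
      (Finset.le_sup (f := fun j => (N.charmatrix.adjugate i j).natDegree)
        (Finset.mem_univ j)).trans (Finset.le_sup
        (f := fun i => Finset.univ.sup fun j => (N.charmatrix.adjugate i j).natDegree)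
        (Finset.mem_univ i))
    exact h1.trans_lt (by lia)
  rw [hpow (d + 1), h0, Matrix.mul_zero]

theorem adjCoeff_last {k : ℕ} (hk : k + 1 = n) : adjCoeff N k = 1 := by
  have h := mul_adjCoeff_succ N k
  rw [adjCoeff_eq_zero N hk.ge, Matrix.mul_zero] at h
  have h1 : N.charpoly.coeff (k + 1) = 1 := by
    have h2 := N.charpoly_monic.coeff_natDegree
    rw [Matrix.charpoly_natDegree_eq_dim, Fintype.card_fin] at h2
    simpa only [hk] using h2
  rw [h1, one_smul] at h
  exact sub_eq_zero.1 h.symm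

end AdjugateCoefficients

/-! ### Companion matrices and cyclic vectors -/

section Companion

variable {n : ℕ}

/-- The last unit vector of `ℝ ^ n`. -/
def lastVec (n : ℕ) : Fin n → ℝ := fun k => if (k : ℕ) + 1 = n then 1 else 0

theorem adjKrylov_mulVec (N : Matrix (Fin n) (Fin n) ℝ) (v g : Fin n → ℝ) :
    adjKrylov N v *ᵥ g = ∑ k, g k • (adjCoeff N (k : ℕ) *ᵥ v) := by
  ext r
  simp [Matrix.mulVec, dotProduct, adjKrylov, Finset.sum_apply, mul_comm]

theorem adjKrylov_mulVec_lastVec (N : Matrix (Fin n) (Fin n) ℝ) (v : Fin n → ℝ) :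
    adjKrylov N v *ᵥ lastVec n = v := by
  rcases n with _ | n
  · exact Subsingleton.elim _ _
  · rw [adjKrylov_mulVec, Finset.sum_eq_single (Fin.last n)]
    · simp [lastVec, adjCoeff_last]
    · intro k _ hk
      have : (k : ℕ) ≠ n := fun h => hk (Fin.ext h)
      simp [lastVec, this]
    · simp

theorem companion_mulVec_of_lt (q : Polynomial ℝ) (g : Fin n → ℝ) (k : Fin n)
    (hk : (k : ℕ) + 1 < n) : (companion n q *ᵥ g) k = g ⟨k + 1, hk⟩ := by
  simp only [Matrix.mulVec, dotProduct, companion, Matrix.of_apply, if_neg hk.ne]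
  rw [Finset.sum_eq_single ⟨k + 1, hk⟩]
  · simp
  · intro j _ hj
    rw [if_neg, zero_mul]
    exact fun h => hj (Fin.ext h.symm)
  · simp

theorem companion_mulVec_last (q : Polynomial ℝ) (g : Fin n → ℝ) (k : Fin n)
    (hk : (k : ℕ) + 1 = n) : (companion n q *ᵥ g) k = -∑ j : Fin n, q.coeff j * g j := by
  simp [Matrix.mulVec, dotProduct, companion, hk]

/-- Applied to `v`, the recursion `N D_k = D_{k-1} - a_k I` combines the previous column with the
last column, which is `v`; this is right multiplication by the companion matrix. -/
theorem adjKrylov_mul_companion (N : Matrix (Fin n) (Fin n) ℝ) (v : Fin n → ℝ) :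
    adjKrylov N v * companion n N.charpoly = N * adjKrylov N v := by
  rcases n with _ | n
  · exact Subsingleton.elim _ _
  refine Matrix.toLin'.injective (LinearMap.ext fun g => ?_)
  simp only [Matrix.toLin'_mul, LinearMap.comp_apply, Matrix.toLin'_apply, adjKrylov_mulVec,
    Matrix.mulVec_sum, Matrix.mulVec_smul]
  rw [Fin.sum_univ_castSucc, Fin.sum_univ_succ (fun k : Fin (n + 1) =>
      g k • N *ᵥ adjCoeff N (k : ℕ) *ᵥ v),
    companion_mulVec_last _ _ _ (by simp), Fin.sum_univ_succ]
  have h1 : ∀ i : Fin n, (companion (n + 1) N.charpoly *ᵥ g) i.castSucc = g i.succ := fun i =>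
    companion_mulVec_of_lt _ _ _ (by simp)
  simp only [h1, Fin.val_zero, Fin.val_castSucc, Fin.val_succ, Fin.val_last,
    Matrix.mulVec_mulVec, mul_adjCoeff_zero, mul_adjCoeff_succ, adjCoeff_last N rfl,
    Matrix.sub_mulVec, Matrix.neg_mulVec, Matrix.smul_mulVec, Matrix.one_mulVec, smul_sub,
    Finset.sum_sub_distrib, neg_smul, add_smul, Finset.sum_smul, smul_neg, smul_smul]
  simp only [mul_comm]
  abel

theorem adjKrylov_mulVec_companion (N : Matrix (Fin n) (Fin n) ℝ) (v g : Fin n → ℝ) :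
    adjKrylov N v *ᵥ (companion n N.charpoly *ᵥ g) = N *ᵥ (adjKrylov N v *ᵥ g) := by
  rw [Matrix.mulVec_mulVec, adjKrylov_mul_companion, Matrix.mulVec_mulVec]

/-- The companion matrix is similar to every matrix with that characteristic polynomial that has a
cyclic vector. -/
theorem isHurwitz_companion {N : Matrix (Fin n) (Fin n) ℝ} (hN : IsHurwitz N) {v : Fin n → ℝ}
    (hv : IsUnit (adjKrylov N v)) : IsHurwitz (companion n N.charpoly) := by
  rw [isHurwitz_iff] at hN ⊢
  intro σ ω a b hσ hab
  obtain ⟨h1, h2⟩ := hN σ ω (adjKrylov N v *ᵥ a) (adjKrylov N v *ᵥ b) hσ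
    ⟨by rw [← adjKrylov_mulVec_companion, hab.re, Matrix.mulVec_sub, Matrix.mulVec_smul,
        Matrix.mulVec_smul],
      by rw [← adjKrylov_mulVec_companion, hab.im, Matrix.mulVec_add, Matrix.mulVec_smul,
        Matrix.mulVec_smul]⟩
  have hinj := Matrix.mulVec_injective_iff_isUnit.2 hv
  exact ⟨hinj (h1.trans (Matrix.mulVec_zero _).symm), hinj (h2.trans (Matrix.mulVec_zero _).symm)⟩

end Companion

/-! ### The filter matrices and the parameterization matrix -/

section Filter

variable {n m p : ℕ}

theorem filterA_mulVec_inl (q : Polynomial ℝ) (Aε : Matrix (Fin n) (Fin n) ℝ)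
    (η : EtaIdx n m p → ℝ) (c : Fin m ⊕ Fin p) (k : Fin n) :
    (filterA m p q Aε *ᵥ η) (Sum.inl (c, k)) =
      (companion n q *ᵥ fun l => η (Sum.inl (c, l))) k := by
  simp only [Matrix.mulVec, dotProduct, filterA, Fintype.sum_sum_type (α₁ := (Fin m ⊕ Fin p) × _),
    Fintype.sum_prod_type]
  rw [Finset.sum_eq_single c]
  · simp
  · intro b _ hb
    simp [hb.symm]
  · simp

theorem filterA_mulVec_inr (q : Polynomial ℝ) (Aε : Matrix (Fin n) (Fin n) ℝ)
    (η : EtaIdx n m p → ℝ) (k : Fin n) :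
    (filterA m p q Aε *ᵥ η) (Sum.inr k) = (Aε *ᵥ fun l => η (Sum.inr l)) k := by
  simp [Matrix.mulVec, dotProduct, filterA]

theorem filterB_mulVec (u : Fin m → ℝ) (y : Fin p → ℝ) :
    filterB n m p *ᵥ Sum.elim (Sum.elim u y) 0 = filterBu n m p *ᵥ u + filterBy n m p *ᵥ y := by
  ext r
  simp [Matrix.mulVec, dotProduct, filterBu, filterBy]

theorem filterBu_mulVec (u : Fin m → ℝ) :
    filterBu n m p *ᵥ u =
      Sum.elim (fun c => Sum.elim (fun i => u i * lastVec n c.2) (fun _ => 0) c.1) 0 := by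
  ext r
  rcases r with ⟨i | j, k⟩ | k <;>
    simp [Matrix.mulVec, dotProduct, filterBu, filterB, lastVec, ite_and]

theorem filterBy_mulVec (y : Fin p → ℝ) :
    filterBy n m p *ᵥ y =
      Sum.elim (fun c => Sum.elim (fun _ => 0) (fun j => y j * lastVec n c.2) c.1) 0 := by
  ext r
  rcases r with ⟨i | j, k⟩ | k <;>
    simp [Matrix.mulVec, dotProduct, filterBy, filterB, lastVec, ite_and]

theorem stateParam_mulVec (M : Matrix (Fin n) (Fin n) ℝ) (B : Matrix (Fin n) (Fin m) ℝ)
    (L : Matrix (Fin n) (Fin p) ℝ) (Aε : Matrix (Fin n) (Fin n) ℝ) (ε₀ η₀ : Fin n → ℝ)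
    (η : EtaIdx n m p → ℝ) :
    stateParam M B L Aε ε₀ η₀ *ᵥ η =
      ∑ i, adjKrylov M (B.col i) *ᵥ (fun k => η (Sum.inl (Sum.inl i, k))) +
      ∑ j, adjKrylov M (L.col j) *ᵥ (fun k => η (Sum.inl (Sum.inr j, k))) +
      adjKrylov M ε₀ *ᵥ ((adjKrylov Aε η₀)⁻¹ *ᵥ fun k => η (Sum.inr k)) := by
  ext r
  rw [Matrix.mulVec_mulVec]
  simp [Matrix.mulVec, dotProduct, stateParam, Fintype.sum_prod_type, Finset.sum_apply]

theorem sum_smul_col {κ : Type*} [Fintype κ] (B : Matrix (Fin n) κ ℝ) (u : κ → ℝ) :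
    ∑ i, u i • B.col i = B *ᵥ u := by
  ext r
  simp [Matrix.mulVec, dotProduct, mul_comm]

section Parameterization

variable (M : Matrix (Fin n) (Fin n) ℝ) (B : Matrix (Fin n) (Fin m) ℝ)
  (L : Matrix (Fin n) (Fin p) ℝ) (Aε : Matrix (Fin n) (Fin n) ℝ) (ε₀ η₀ : Fin n → ℝ)

theorem stateParam_mulVec_filterBu (u : Fin m → ℝ) :
    stateParam M B L Aε ε₀ η₀ *ᵥ (filterBu n m p *ᵥ u) = B *ᵥ u := by
  have h : ∀ i, (fun k => u i * lastVec n k) = u i • lastVec n := fun i => rfl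
  have h0 : (fun _ : Fin n => (0 : ℝ)) = 0 := rfl
  simp only [stateParam_mulVec, filterBu_mulVec, Sum.elim_inl, Sum.elim_inr, h, Pi.zero_apply, h0,
    Matrix.mulVec_zero, Matrix.mulVec_smul, adjKrylov_mulVec_lastVec, Finset.sum_const_zero,
    add_zero, sum_smul_col]

theorem stateParam_mulVec_filterBy (y : Fin p → ℝ) :
    stateParam M B L Aε ε₀ η₀ *ᵥ (filterBy n m p *ᵥ y) = L *ᵥ y := by
  have h : ∀ i, (fun k => y i * lastVec n k) = y i • lastVec n := fun i => rfl
  have h0 : (fun _ : Fin n => (0 : ℝ)) = 0 := rfl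
  simp only [stateParam_mulVec, filterBy_mulVec, Sum.elim_inl, Sum.elim_inr, h, Pi.zero_apply, h0,
    Matrix.mulVec_zero, Matrix.mulVec_smul, adjKrylov_mulVec_lastVec, Finset.sum_const_zero,
    add_zero, zero_add, sum_smul_col]

variable {Aε η₀}

theorem adjKrylov_inv_mulVec (hη₀ : IsUnit (adjKrylov Aε η₀)) (g : Fin n → ℝ) :
    (adjKrylov Aε η₀)⁻¹ *ᵥ (adjKrylov Aε η₀ *ᵥ g) = g := by
  rw [Matrix.mulVec_mulVec, Matrix.nonsing_inv_mul _ ((Matrix.isUnit_iff_isUnit_det _).1 hη₀),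
    Matrix.one_mulVec]

theorem adjKrylov_mulVec_inv (hη₀ : IsUnit (adjKrylov Aε η₀)) (g : Fin n → ℝ) :
    adjKrylov Aε η₀ *ᵥ ((adjKrylov Aε η₀)⁻¹ *ᵥ g) = g := by
  rw [Matrix.mulVec_mulVec, Matrix.mul_nonsing_inv _ ((Matrix.isUnit_iff_isUnit_det _).1 hη₀),
    Matrix.one_mulVec]

theorem stateParam_mulVec_initial (hη₀ : IsUnit (adjKrylov Aε η₀)) :
    stateParam M B L Aε ε₀ η₀ *ᵥ Sum.elim (fun _ => 0) η₀ = ε₀ := by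
  have h0 : (fun _ : Fin n => (0 : ℝ)) = 0 := rfl
  have h1 : (adjKrylov Aε η₀)⁻¹ *ᵥ η₀ = lastVec n := by
    conv_lhs => rw [← adjKrylov_mulVec_lastVec Aε η₀]
    rw [adjKrylov_mulVec_lastVec, ← adjKrylov_inv_mulVec hη₀ (lastVec n),
      adjKrylov_mulVec_lastVec]
  simp only [stateParam_mulVec, Sum.elim_inl, Sum.elim_inr, h0, Matrix.mulVec_zero,
    Finset.sum_const_zero, zero_add, h1, adjKrylov_mulVec_lastVec]

/-- Every block of `S` intertwines the companion matrix with `M`. In the last block `Aε` is first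
conjugated to that same companion matrix, which uses the equality of characteristic polynomials. -/
theorem stateParam_mulVec_filterA (hAε : Aε.charpoly = M.charpoly)
    (hη₀ : IsUnit (adjKrylov Aε η₀)) (η : EtaIdx n m p → ℝ) :
    stateParam M B L Aε ε₀ η₀ *ᵥ (filterA m p M.charpoly Aε *ᵥ η) =
      M *ᵥ (stateParam M B L Aε ε₀ η₀ *ᵥ η) := by
  have h1 : ∀ g : Fin n → ℝ, (adjKrylov Aε η₀)⁻¹ *ᵥ (Aε *ᵥ g) =
      companion n M.charpoly *ᵥ ((adjKrylov Aε η₀)⁻¹ *ᵥ g) := by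
    intro g
    conv_lhs => rw [← adjKrylov_mulVec_inv hη₀ g]
    rw [← adjKrylov_mulVec_companion, adjKrylov_inv_mulVec hη₀, hAε]
  simp only [stateParam_mulVec, filterA_mulVec_inl, filterA_mulVec_inr]
  simp only [Matrix.mulVec_add, Matrix.mulVec_sum, ← adjKrylov_mulVec_companion]
  congr 2
  exact h1 _

end Parameterization

end Filter

/-! ### An invariant subspace containing the substitute state -/

section ReachableSpace

variable {n m p : ℕ}

/-- Coordinates `(ξ, η^u, g)` of the space that contains the substitute state. -/
abbrev ReachCoord (n m : ℕ) : Type := (Fin n → ℝ) × (Fin m → Fin n → ℝ) × (Fin n → ℝ)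

/-- The `k`-th derivative of the input that drives `ξ`. -/
def reachInput (B : Matrix (Fin n) (Fin m) ℝ) (x₀ : Fin n → ℝ) (k : ℕ) :
    ReachCoord n m →ₗ[ℝ] (Fin n → ℝ) where
  -- The value `0` for `k ≥ n` plays no role: derivatives of `ξ` are needed only up to order `n`.
  toFun z := if h : k < n then B *ᵥ (fun i => z.2.1 i ⟨k, h⟩) + z.2.2 ⟨k, h⟩ • x₀ else 0
  map_add' z w := by
    split_ifs with h
    · have : (fun i => (z + w).2.1 i ⟨k, h⟩) =
        (fun i => z.2.1 i ⟨k, h⟩) + fun i => w.2.1 i ⟨k, h⟩ := rfl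
      rw [this, Matrix.mulVec_add, Prod.snd_add, Prod.snd_add, Pi.add_apply, add_smul]
      abel
    · simp
  map_smul' c z := by
    split_ifs with h
    · have : (fun i => (c • z).2.1 i ⟨k, h⟩) = c • (fun i => z.2.1 i ⟨k, h⟩) := rfl
      rw [this, Matrix.mulVec_smul, Prod.smul_snd, Prod.smul_snd, Pi.smul_apply, smul_assoc,
        RingHom.id_apply, smul_add]
    · simp

/-- The `k`-th derivative of `ξ`, where `ξ' = A ξ + B η^u_0 + g_0 x₀`. -/
def reachState (A : Matrix (Fin n) (Fin n) ℝ) (B : Matrix (Fin n) (Fin m) ℝ) (x₀ : Fin n → ℝ) :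
    ℕ → ReachCoord n m →ₗ[ℝ] (Fin n → ℝ)
  | 0 => LinearMap.fst ℝ _ _
  | k + 1 => A.mulVecLin ∘ₗ reachState A B x₀ k + reachInput B x₀ k

/-- The substitute state as a function of the coordinates `(ξ, η^u, g)`. -/
def reachMap (A : Matrix (Fin n) (Fin n) ℝ) (B : Matrix (Fin n) (Fin m) ℝ)
    (C : Matrix (Fin p) (Fin n) ℝ) (x₀ : Fin n → ℝ) (Kε : Matrix (Fin n) (Fin n) ℝ) :
    ReachCoord n m →ₗ[ℝ] (EtaIdx n m p → ℝ) where
  toFun z := Sum.elim (fun c => Sum.elim (fun i => z.2.1 i c.2)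
    (fun j => (C *ᵥ reachState A B x₀ c.2 z) j) c.1) (Kε *ᵥ z.2.2)
  map_add' z w := by
    ext ((⟨i | j, k⟩) | k) <;> simp [Matrix.mulVec_add]
  map_smul' c z := by
    ext ((⟨i | j, k⟩) | k) <;> simp [Matrix.mulVec_smul]

/-- The dynamics of the coordinates `(ξ, η^u, g)` without input. -/
def reachShift (A : Matrix (Fin n) (Fin n) ℝ) (B : Matrix (Fin n) (Fin m) ℝ) (x₀ : Fin n → ℝ)
    (q : Polynomial ℝ) (z : ReachCoord n m) : ReachCoord n m :=
  (reachState A B x₀ 1 z, fun i => companion n q *ᵥ z.2.1 i, companion n q *ᵥ z.2.2)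

variable (A : Matrix (Fin n) (Fin n) ℝ) (B : Matrix (Fin n) (Fin m) ℝ)
  (C : Matrix (Fin p) (Fin n) ℝ) (x₀ : Fin n → ℝ)

theorem reachInput_of_lt {k : ℕ} (hk : k < n) (z : ReachCoord n m) :
    reachInput B x₀ k z = B *ᵥ (fun i => z.2.1 i ⟨k, hk⟩) + z.2.2 ⟨k, hk⟩ • x₀ :=
  dif_pos hk

theorem reachState_succ (k : ℕ) (z : ReachCoord n m) :
    reachState A B x₀ (k + 1) z = A *ᵥ reachState A B x₀ k z + reachInput B x₀ k z := rfl

theorem reachInput_shift (q : Polynomial ℝ) {k : ℕ} (hk : k + 1 < n) (z : ReachCoord n m) :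
    reachInput B x₀ k (reachShift A B x₀ q z) = reachInput B x₀ (k + 1) z := by
  rw [reachInput_of_lt B x₀ (by lia), reachInput_of_lt B x₀ hk]
  have h : ∀ g : Fin n → ℝ, (companion n q *ᵥ g) ⟨k, by lia⟩ = g ⟨k + 1, hk⟩ := fun g =>
    companion_mulVec_of_lt q g ⟨k, by lia⟩ hk
  simp only [reachShift, h]

/-- All rows of the companion matrix but the last are shifts, so the autonomous dynamics raise the
order of the derivative by one. -/
theorem reachState_shift (q : Polynomial ℝ) {k : ℕ} (hk : k < n) (z : ReachCoord n m) :
    reachState A B x₀ k (reachShift A B x₀ q z) = reachState A B x₀ (k + 1) z := by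
  induction k with
  | zero => rfl
  | succ k ih => rw [reachState_succ, ih (by lia), reachInput_shift A B x₀ q hk,
      reachState_succ A B x₀ (k + 1)]

/-- A partial sum of `adj (s I - M) (s I - M) = q(s) I`, with `s` read as the index shift; it
telescopes by `D_k M = D_{k-1} - a_k I`. -/
theorem sum_adjCoeff_mulVec (M : Matrix (Fin n) (Fin n) ℝ) (ξ : ℕ → Fin n → ℝ) (j : ℕ) :
    ∑ k ∈ Finset.range (j + 1), adjCoeff M k *ᵥ (ξ (k + 1) - M *ᵥ ξ k) =
      adjCoeff M j *ᵥ ξ (j + 1) +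
        ∑ k ∈ Finset.range (j + 1), M.charpoly.coeff k • ξ k := by
  induction j with
  | zero =>
    simp [Matrix.mulVec_sub, Matrix.mulVec_mulVec, adjCoeff_zero_mul, Matrix.neg_mulVec,
      Matrix.smul_mulVec]
  | succ j ih =>
    rw [Finset.sum_range_succ, ih, Finset.sum_range_succ _ (j + 1), Matrix.mulVec_sub,
      Matrix.mulVec_mulVec, adjCoeff_succ_mul, Matrix.sub_mulVec, Matrix.smul_mulVec,
      Matrix.one_mulVec]
    abel

/-- `S` undoes the filtering: the result is `q(d/dt) ξ`. Since `A = M + L C`, the contributions of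
index `k` add up to `D_k (ξ^(k+1) - M ξ^(k))`. -/
theorem stateParam_mulVec_reachMap (L : Matrix (Fin n) (Fin p) ℝ) {Aε : Matrix (Fin n) (Fin n) ℝ}
    {η₀ : Fin n → ℝ} (hη₀ : IsUnit (adjKrylov Aε η₀)) (z : ReachCoord n m) :
    stateParam (A - L * C) B L Aε x₀ η₀ *ᵥ reachMap A B C x₀ (adjKrylov Aε η₀) z =
      reachState A B x₀ n z +
        ∑ k ∈ Finset.range n, (A - L * C).charpoly.coeff k • reachState A B x₀ k z := by
  set M := A - L * C with hM
  have h1 : stateParam M B L Aε x₀ η₀ *ᵥ reachMap A B C x₀ (adjKrylov Aε η₀) z =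
      ∑ k ∈ Finset.range n, adjCoeff M k *ᵥ
        (reachState A B x₀ (k + 1) z - M *ᵥ reachState A B x₀ k z) := by
    rw [stateParam_mulVec, Finset.sum_range]
    simp only [reachMap, LinearMap.coe_mk, AddHom.coe_mk, Sum.elim_inl, Sum.elim_inr]
    rw [adjKrylov_inv_mulVec hη₀]
    simp only [adjKrylov_mulVec]
    rw [Finset.sum_comm, Finset.sum_comm (s := (Finset.univ : Finset (Fin p))),
      ← Finset.sum_add_distrib, ← Finset.sum_add_distrib]
    refine Finset.sum_congr rfl fun k _ => ?_
    have hlc : reachState A B x₀ (k + 1) z - M *ᵥ reachState A B x₀ k z =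
        ∑ i, z.2.1 i k • B.col i +
        ∑ j, (C *ᵥ reachState A B x₀ k z) j • L.col j + z.2.2 k • x₀ := by
      rw [sum_smul_col, sum_smul_col, reachState_succ, reachInput_of_lt B x₀ k.2, hM,
        Matrix.sub_mulVec, Matrix.mulVec_mulVec]
      abel
    rw [hlc]
    simp only [Matrix.mulVec_add, Matrix.mulVec_sum, Matrix.mulVec_smul]
  rw [h1]
  rcases n with _ | n
  · exact Subsingleton.elim _ _
  · have := sum_adjCoeff_mulVec M (fun k => reachState A B x₀ k z) n
    rwa [adjCoeff_last M rfl, Matrix.one_mulVec] at this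

/-- The dynamics of the substitute state in closed form, `η' = 𝒜 η + ℬ^u u`. -/
noncomputable def substituteA (A : Matrix (Fin n) (Fin n) ℝ) (B : Matrix (Fin n) (Fin m) ℝ)
    (C : Matrix (Fin p) (Fin n) ℝ) (L : Matrix (Fin n) (Fin p) ℝ)
    (Aε : Matrix (Fin n) (Fin n) ℝ) (x₀ η₀ : Fin n → ℝ) :
    Matrix (EtaIdx n m p) (EtaIdx n m p) ℝ :=
  filterA m p (A - L * C).charpoly Aε + filterBy n m p * C * stateParam (A - L * C) B L Aε x₀ η₀

theorem substituteA_mulVec (L : Matrix (Fin n) (Fin p) ℝ) (Aε : Matrix (Fin n) (Fin n) ℝ)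
    (η₀ : Fin n → ℝ) (η : EtaIdx n m p → ℝ) :
    substituteA A B C L Aε x₀ η₀ *ᵥ η = filterA m p (A - L * C).charpoly Aε *ᵥ η +
      filterBy n m p *ᵥ (C *ᵥ (stateParam (A - L * C) B L Aε x₀ η₀ *ᵥ η)) := by
  simp only [substituteA, Matrix.add_mulVec, Matrix.mulVec_mulVec, Matrix.mul_assoc]

/-- The filter contributes `A - L C`, and feeding back the output restores `L C`. -/
theorem stateParam_mulVec_substituteA (L : Matrix (Fin n) (Fin p) ℝ)
    {Aε : Matrix (Fin n) (Fin n) ℝ} {η₀ : Fin n → ℝ} (hAε : Aε.charpoly = (A - L * C).charpoly)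
    (hη₀ : IsUnit (adjKrylov Aε η₀)) (η : EtaIdx n m p → ℝ) :
    stateParam (A - L * C) B L Aε x₀ η₀ *ᵥ (substituteA A B C L Aε x₀ η₀ *ᵥ η) =
      A *ᵥ (stateParam (A - L * C) B L Aε x₀ η₀ *ᵥ η) := by
  rw [substituteA_mulVec, Matrix.mulVec_add, stateParam_mulVec_filterA _ _ _ _ hAε hη₀,
    stateParam_mulVec_filterBy, Matrix.sub_mulVec, Matrix.mulVec_mulVec _ L C, sub_add_cancel]

/-- Only the last row of an output block is at stake: the companion matrix gives `-∑ a_k C ξ^(k)`,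
the fed-back output gives `C q(d/dt) ξ`, and their sum is `C ξ^(n)`. -/
theorem substituteA_mulVec_reachMap (L : Matrix (Fin n) (Fin p) ℝ)
    {Aε : Matrix (Fin n) (Fin n) ℝ} {η₀ : Fin n → ℝ} (hAε : Aε.charpoly = (A - L * C).charpoly)
    (hη₀ : IsUnit (adjKrylov Aε η₀)) (z : ReachCoord n m) :
    substituteA A B C L Aε x₀ η₀ *ᵥ reachMap A B C x₀ (adjKrylov Aε η₀) z =
      reachMap A B C x₀ (adjKrylov Aε η₀) (reachShift A B x₀ (A - L * C).charpoly z) := by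
  rw [substituteA_mulVec, stateParam_mulVec_reachMap A B C x₀ L hη₀]
  ext ((⟨i | j, k⟩) | k)
  · rw [Pi.add_apply, filterA_mulVec_inl, filterBy_mulVec]
    simp [reachMap, reachShift]
  · rw [Pi.add_apply, filterA_mulVec_inl, filterBy_mulVec]
    simp only [reachMap, LinearMap.coe_mk, AddHom.coe_mk, Sum.elim_inl, Sum.elim_inr]
    rw [reachState_shift A B x₀ _ k.2]
    by_cases hk : (k : ℕ) + 1 < n
    · rw [companion_mulVec_of_lt _ _ _ hk, lastVec, if_neg hk.ne, mul_zero, add_zero]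
    · have hk' : (k : ℕ) + 1 = n := by lia
      rw [companion_mulVec_last _ _ _ hk', lastVec, if_pos hk', mul_one, Matrix.mulVec_add,
        Pi.add_apply, Finset.sum_range, Matrix.mulVec_sum, Finset.sum_apply, hk']
      simp only [Matrix.mulVec_smul, Pi.smul_apply, smul_eq_mul]
      ring
  · rw [Pi.add_apply, filterA_mulVec_inr, filterBy_mulVec]
    simp only [reachMap, LinearMap.coe_mk, AddHom.coe_mk, Sum.elim_inr, Pi.zero_apply, add_zero,
      reachShift]
    rw [← hAε, adjKrylov_mulVec_companion]

/-- What enters in the last slot of a chain affects only the derivative of `ξ` of order `n`. This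
places both the input directions and the initial value in the range of `reachMap`. -/
theorem reachState_last (c : Fin m → ℝ) (d : ℝ) {k : ℕ} (hk : k < n) :
    reachState A B x₀ k (0, fun i => c i • lastVec n, d • lastVec n) = 0 := by
  induction k with
  | zero => rfl
  | succ k ih =>
    have h0 : lastVec n ⟨k, by lia⟩ = 0 := if_neg hk.ne
    rw [reachState_succ, ih (by lia), reachInput_of_lt B x₀ (by lia)]
    have h1 : (fun i => (c i • lastVec n) ⟨k, by lia⟩) = 0 := by
      ext i
      simp [h0]
    simp only [Pi.smul_apply, h0, smul_eq_mul, mul_zero, zero_smul, Matrix.mulVec_zero, add_zero, zero_add]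
    exact Matrix.mulVec_zero B

theorem filterBu_mulVec_mem_range (Kε : Matrix (Fin n) (Fin n) ℝ) (c : Fin m → ℝ) :
    filterBu n m p *ᵥ c ∈ LinearMap.range (reachMap A B C x₀ Kε) := by
  -- The zero in `g` is written as a multiple of `lastVec n` to match `reachState_last`.
  refine ⟨(0, fun i => c i • lastVec n, (0 : ℝ) • lastVec n), ?_⟩
  rw [filterBu_mulVec]
  ext ((⟨i | j, k⟩) | k)
  · simp [reachMap]
  · simp [-zero_smul, reachMap, reachState_last A B x₀ c 0 k.2]
  · simp [reachMap]

theorem initial_mem_range (Aε : Matrix (Fin n) (Fin n) ℝ) (η₀ : Fin n → ℝ) :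
    (Sum.elim (fun _ => 0) η₀ : EtaIdx n m p → ℝ) ∈
      LinearMap.range (reachMap A B C x₀ (adjKrylov Aε η₀)) := by
  refine ⟨(0, fun i => (0 : Fin m → ℝ) i • lastVec n, (1 : ℝ) • lastVec n), ?_⟩
  ext ((⟨i | j, k⟩) | k)
  · simp [reachMap]
  · have := reachState_last A B x₀ 0 1 k.2
    change (C *ᵥ reachState A B x₀ k _) j = 0
    rw [this, Matrix.mulVec_zero, Pi.zero_apply]
  · simp [reachMap, adjKrylov_mulVec_lastVec]

theorem finrank_range_reachMap_le (Kε : Matrix (Fin n) (Fin n) ℝ) :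
    Module.finrank ℝ (LinearMap.range (reachMap A B C x₀ Kε)) ≤ (m + 2) * n := by
  refine (LinearMap.finrank_range_le _).trans (le_of_eq ?_)
  simp only [ReachCoord, Module.finrank_prod, Module.finrank_pi_fintype, Module.finrank_self,
    Finset.sum_const, Finset.card_univ, Fintype.card_fin, smul_eq_mul]
  ring

end ReachableSpace

/-! ### Invariant subspaces and linear differential equations -/

section Trajectories

variable {ι : Type*} [Fintype ι]

theorem HasDerivWithinAt.matrix_mulVec {κ : Type*} [Fintype κ] {f : ℝ → ι → ℝ} {f' : ι → ℝ}
    {s : Set ℝ} {t : ℝ} (M : Matrix κ ι ℝ) (hf : HasDerivWithinAt f f' s t) :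
    HasDerivWithinAt (fun s => M *ᵥ f s) (M *ᵥ f') s t :=
  (LinearMap.toContinuousLinearMap (Matrix.mulVecLin M)).hasFDerivAt.comp_hasDerivWithinAt t hf

theorem linear_ode_eq_zero (M : Matrix ι ι ℝ) {f : ℝ → ι → ℝ}
    (hf : ∀ s : ℝ, 0 ≤ s → HasDerivWithinAt f (M *ᵥ f s) (Set.Ici 0) s) (h0 : f 0 = 0) {s : ℝ}
    (hs : 0 ≤ s) : f s = 0 := by
  obtain ⟨K, hK⟩ : ∃ K, LipschitzWith K (fun y : ι → ℝ => M *ᵥ y) :=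
    ⟨_, (LinearMap.toContinuousLinearMap (Matrix.mulVecLin M)).lipschitz⟩
  have h := ODE_solution_unique (v := fun _ y => M *ᵥ y) (f := f) (g := fun _ => 0) (a := 0)
    (b := s) (fun _ => hK)
    (fun t ht => ((hf t ht.1).continuousWithinAt).mono Set.Icc_subset_Ici_self)
    (fun t ht => (hf t ht.1).mono (Set.Ici_subset_Ici.2 ht.1)) continuousOn_const
    (fun t _ => by
      rw [Matrix.mulVec_zero]
      exact hasDerivWithinAt_const _ _ _) h0
  exact h ⟨hs, le_rfl⟩

/-- A trajectory that starts in an invariant subspace and is driven inside of it stays there. -/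
theorem mem_of_linear_ode [DecidableEq ι] (M : Matrix ι ι ℝ) (W : Submodule ℝ (ι → ℝ))
    (hW : ∀ w ∈ W, M *ᵥ w ∈ W)
    {f b : ℝ → ι → ℝ} (hb : ∀ s, b s ∈ W)
    (hf : ∀ s : ℝ, 0 ≤ s → HasDerivWithinAt f (M *ᵥ f s + b s) (Set.Ici 0) s) (h0 : f 0 ∈ W)
    {s : ℝ} (hs : 0 ≤ s) : f s ∈ W := by
  obtain ⟨W', hW'⟩ := W.exists_isCompl
  -- The projection with kernel `W` removes `b`, and `π M f = π M π f` by invariance. So `π f`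
  -- solves a homogeneous equation, and no regularity of `b` is needed.
  set π : (ι → ℝ) →ₗ[ℝ] (ι → ℝ) := W'.projection W hW'.symm
  have hker : ∀ w, π w = 0 ↔ w ∈ W := by
    intro w
    simp [π]
  have hsub : ∀ w, w - π w ∈ W := by
    intro w
    exact Submodule.sub_projection_mem hW'.symm w
  have hπ : ∀ w, LinearMap.toMatrix' π *ᵥ w = π w := fun w => by
    rw [← Matrix.toLin'_apply, Matrix.toLin'_toMatrix']
  rw [← hker]
  refine linear_ode_eq_zero (LinearMap.toMatrix' π * M) (f := fun s => π (f s)) ?_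
    ((hker _).2 h0) hs
  intro t ht
  have h1 := HasDerivWithinAt.matrix_mulVec (LinearMap.toMatrix' π) (hf t ht)
  simp only [hπ] at h1
  convert! h1 using 1
  rw [← Matrix.mulVec_mulVec, hπ, map_add, (hker _).2 (hb t), add_zero]
  have h2 := (hker _).2 (hW _ (hsub (f t)))
  rw [Matrix.mulVec_sub, map_sub, sub_eq_zero] at h2
  exact h2.symm

end Trajectories

/-! ### From observability of the plant to detectability of the transformed problem -/

section Detectability

theorem mulVec_injective_of_rank {ι κ : Type*} [Fintype ι] [Fintype κ] [DecidableEq κ]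
    {M : Matrix ι κ ℝ} (h : M.rank = Fintype.card κ) {x : κ → ℝ} (hx : M *ᵥ x = 0) : x = 0 := by
  have h1 := LinearMap.finrank_range_add_finrank_ker M.mulVecLin
  rw [← Matrix.rank, h, Module.finrank_fintype_fun_eq_card, Nat.add_eq_left,
    Submodule.finrank_eq_zero] at h1
  have h2 : x ∈ LinearMap.ker M.mulVecLin := hx
  rwa [h1, Submodule.mem_bot] at h2

/-- The span of `a` and `b` is invariant under `A` and lies in the kernel of `C`, so every `C A ^ k`
vanishes on it. -/
theorem IsEigenpair.eq_zero_of_isObservable {n : ℕ} {κ : Type*} [Fintype κ]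
    {A : Matrix (Fin n) (Fin n) ℝ} {C : Matrix κ (Fin n) ℝ} (hAC : IsObservable A C) {σ ω : ℝ}
    {a b : Fin n → ℝ} (h : IsEigenpair A σ ω a b) (ha : C *ᵥ a = 0) (hb : C *ᵥ b = 0) :
    a = 0 ∧ b = 0 := by
  have hk : ∀ k : ℕ, (C * A ^ k) *ᵥ a = 0 ∧ (C * A ^ k) *ᵥ b = 0 := by
    intro k
    induction k with
    | zero => simpa using ⟨ha, hb⟩
    | succ k ih =>
      rw [pow_succ, ← Matrix.mul_assoc, ← Matrix.mulVec_mulVec _ _ A, ← Matrix.mulVec_mulVec _ _ A,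
        h.re, h.im]
      simp [Matrix.mulVec_sub, Matrix.mulVec_add, Matrix.mulVec_smul, ih]
  have hr : (Matrix.of fun (k : Fin n × κ) (j : Fin n) => (C * A ^ (k.1 : ℕ)) k.2 j).rank =
      Fintype.card (Fin n) := by
    rw [Fintype.card_fin]
    exact hAC
  exact ⟨mulVec_injective_of_rank hr (funext fun k => congrFun (hk k.1).1 k.2),
    mulVec_injective_of_rank hr (funext fun k => congrFun (hk k.1).2 k.2)⟩

open scoped MatrixOrder in
theorem psdSqrt_mulVec_eq_zero {n : ℕ} {M : Matrix (Fin n) (Fin n) ℝ} (hM : M.PosSemidef)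
    {x : Fin n → ℝ} (hx : M *ᵥ x = 0) : psdSqrt M *ᵥ x = 0 := by
  have h1 : psdSqrt M * psdSqrt M = M := CFC.sqrt_mul_sqrt_self M hM.nonneg
  have h2 : (psdSqrt M).PosSemidef := Matrix.nonneg_iff_posSemidef.1 (CFC.sqrt_nonneg M)
  have h3 : (psdSqrt M *ᵥ x) ⬝ᵥ (psdSqrt M *ᵥ x) = 0 := by
    rw [Matrix.dotProduct_mulVec, ← Matrix.mulVec_transpose, h2.isSymm_real.eq,
      Matrix.mulVec_mulVec, h1, hx, zero_dotProduct]
  exact dotProduct_self_eq_zero.1 h3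

theorem isHurwitz_filterA {n m p : ℕ} {q : Polynomial ℝ} {Aε : Matrix (Fin n) (Fin n) ℝ}
    (hq : IsHurwitz (companion n q)) (hAε : IsHurwitz Aε) : IsHurwitz (filterA m p q Aε) := by
  rw [isHurwitz_iff] at hq hAε ⊢
  intro σ ω a b hσ hab
  have h1 : ∀ c, (fun k => a (Sum.inl (c, k))) = 0 ∧ (fun k => b (Sum.inl (c, k))) = 0 := by
    intro c
    refine hq σ ω _ _ hσ ⟨funext fun k => ?_, funext fun k => ?_⟩
    · rw [← filterA_mulVec_inl, hab.re]
      rfl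
    · rw [← filterA_mulVec_inl, hab.im]
      rfl
  have h2 : (fun k => a (Sum.inr k)) = 0 ∧ (fun k => b (Sum.inr k)) = 0 := by
    refine hAε σ ω _ _ hσ ⟨funext fun k => ?_, funext fun k => ?_⟩
    · rw [← filterA_mulVec_inr, hab.re]
      rfl
    · rw [← filterA_mulVec_inr, hab.im]
      rfl
  constructor
  · ext (⟨c, k⟩ | k)
    · exact congrFun (h1 c).1 k
    · exact congrFun h2.1 k
  · ext (⟨c, k⟩ | k)
    · exact congrFun (h1 c).2 k
    · exact congrFun h2.2 k

/-- Restricting the substitute dynamics to an invariant subspace keeps the output weight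
detectable. -/
theorem isDetectable_restriction {n m p N : ℕ} {A : Matrix (Fin n) (Fin n) ℝ}
    {B : Matrix (Fin n) (Fin m) ℝ} {C : Matrix (Fin p) (Fin n) ℝ} {Q : Matrix (Fin p) (Fin p) ℝ}
    (hQ : Q.PosSemidef) (hAQ : IsObservable A (psdSqrt (Cᵀ * Q * C)))
    {L : Matrix (Fin n) (Fin p) ℝ} (hL : IsHurwitz (A - L * C))
    {Aε : Matrix (Fin n) (Fin n) ℝ} (hAε : Aε.charpoly = (A - L * C).charpoly)
    {x₀ η₀ : Fin n → ℝ} (hη₀ : IsUnit (adjKrylov Aε η₀))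
    {F₁ : Matrix (Fin N) (EtaIdx n m p) ℝ} (hF₁ : F₁ * F₁ᵀ = 1)
    (hinv : ∀ v, F₁ᵀ *ᵥ (F₁ *ᵥ (substituteA A B C L Aε x₀ η₀ *ᵥ (F₁ᵀ *ᵥ v))) =
      substituteA A B C L Aε x₀ η₀ *ᵥ (F₁ᵀ *ᵥ v)) :
    IsDetectable (F₁ * substituteA A B C L Aε x₀ η₀ * F₁ᵀ)
      (F₁ * (stateParam (A - L * C) B L Aε x₀ η₀)ᵀ * Cᵀ * Q * C *
        stateParam (A - L * C) B L Aε x₀ η₀ * F₁ᵀ) := by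
  intro σ ω v w hσ hvw hv hw
  set S := stateParam (A - L * C) B L Aε x₀ η₀ with hS
  set 𝒜 := substituteA A B C L Aε x₀ η₀ with h𝒜
  -- Because the range of `F₁ᵀ` is invariant, `F₁ᵀ` lifts an eigenpair of the compression to one of
  -- `𝒜`.
  have hre : 𝒜 *ᵥ (F₁ᵀ *ᵥ v) = σ • F₁ᵀ *ᵥ v - ω • F₁ᵀ *ᵥ w := by
    have := congrArg (F₁ᵀ *ᵥ ·) hvw.re
    simp only [← Matrix.mulVec_mulVec, hinv, Matrix.mulVec_sub, Matrix.mulVec_smul] at this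
    exact this
  have him : 𝒜 *ᵥ (F₁ᵀ *ᵥ w) = ω • F₁ᵀ *ᵥ v + σ • F₁ᵀ *ᵥ w := by
    have := congrArg (F₁ᵀ *ᵥ ·) hvw.im
    simp only [← Matrix.mulVec_mulVec, hinv, Matrix.mulVec_add, Matrix.mulVec_smul] at this
    exact this
  have hker : ∀ v, (F₁ * Sᵀ * Cᵀ * Q * C * S * F₁ᵀ) *ᵥ v = 0 →
      psdSqrt (Cᵀ * Q * C) *ᵥ (S *ᵥ (F₁ᵀ *ᵥ v)) = 0 := by
    intro v hv
    have hpsd := posSemidef_transpose_mul_mul hQ C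
    refine psdSqrt_mulVec_eq_zero hpsd (mulVec_eq_zero_of_posSemidef hpsd (le_of_eq ?_))
    have h1 := dotProduct_transpose_mul_mul (S * F₁ᵀ) (Cᵀ * Q * C) v
    have h2 : (S * F₁ᵀ)ᵀ * (Cᵀ * Q * C) * (S * F₁ᵀ) = F₁ * Sᵀ * Cᵀ * Q * C * S * F₁ᵀ := by
      simp only [Matrix.transpose_mul, Matrix.transpose_transpose, Matrix.mul_assoc]
    rw [h2, hv, dotProduct_zero, ← Matrix.mulVec_mulVec] at h1
    exact h1.symm
  have hSA := stateParam_mulVec_substituteA A B C x₀ L hAε hη₀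
  have hpair : IsEigenpair A σ ω (S *ᵥ (F₁ᵀ *ᵥ v)) (S *ᵥ (F₁ᵀ *ᵥ w)) := by
    constructor
    · rw [← hSA, ← h𝒜, hre, Matrix.mulVec_sub, Matrix.mulVec_smul, Matrix.mulVec_smul]
    · rw [← hSA, ← h𝒜, him, Matrix.mulVec_add, Matrix.mulVec_smul, Matrix.mulVec_smul]
  obtain ⟨hSv, hSw⟩ := hpair.eq_zero_of_isObservable hAQ (hker v hv) (hker w hw)
  have hHε : IsHurwitz Aε := hL.of_charpoly_eq hAε
  have hH : IsHurwitz (filterA m p (A - L * C).charpoly Aε) :=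
    isHurwitz_filterA (hAε ▸ isHurwitz_companion hHε hη₀) hHε
  -- The lifted vectors lie in the kernel of `S`, where the output feedback disappears and only the
  -- Hurwitz filter matrix acts.
  have hfv : 𝒜 *ᵥ (F₁ᵀ *ᵥ v) = filterA m p (A - L * C).charpoly Aε *ᵥ (F₁ᵀ *ᵥ v) := by
    rw [h𝒜, substituteA_mulVec, ← hS, hSv, Matrix.mulVec_zero, Matrix.mulVec_zero, add_zero]
  have hfw : 𝒜 *ᵥ (F₁ᵀ *ᵥ w) = filterA m p (A - L * C).charpoly Aε *ᵥ (F₁ᵀ *ᵥ w) := by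
    rw [h𝒜, substituteA_mulVec, ← hS, hSw, Matrix.mulVec_zero, Matrix.mulVec_zero, add_zero]
  obtain ⟨h1, h2⟩ := (isHurwitz_iff _).1 hH σ ω _ _ hσ
    ⟨hfv.symm.trans hre, hfw.symm.trans him⟩
  have hleft : ∀ v, F₁ᵀ *ᵥ v = 0 → v = 0 := by
    intro v hv
    rw [← Matrix.one_mulVec v, ← hF₁, ← Matrix.mulVec_mulVec, hv, Matrix.mulVec_zero]
  exact ⟨hleft v h1, hleft w h2⟩

end Detectability

/-! ### Full row rank data -/

section Data

theorem exists_right_inverse_of_rank {N T : ℕ} {Φ : Matrix (Fin N) (Fin T) ℝ} (h : Φ.rank = N) :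
    ∃ Z : Matrix (Fin T) (Fin N) ℝ, Φ * Z = 1 := by
  rw [← Matrix.mulVec_surjective_iff_exists_right_inverse]
  have : LinearMap.range Φ.mulVecLin = ⊤ := Submodule.eq_top_of_finrank_eq (by
    rw [← Matrix.rank, h, Module.finrank_fintype_fun_eq_card, Fintype.card_fin])
  exact LinearMap.range_eq_top.1 this

/-- With full row rank data, the data equation is the Lyapunov equation. -/
theorem policyEvaluation_iff {N m p T : ℕ} {Φ₀ Φ₁ : Matrix (Fin N) (Fin T) ℝ}
    {U₀ : Matrix (Fin m) (Fin T) ℝ} {Y₀ : Matrix (Fin p) (Fin T) ℝ}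
    {A : Matrix (Fin N) (Fin N) ℝ} {B : Matrix (Fin N) (Fin m) ℝ} {H : Matrix (Fin p) (Fin N) ℝ}
    {Q : Matrix (Fin p) (Fin p) ℝ} {R : Matrix (Fin m) (Fin m) ℝ} (hrank : Φ₀.rank = N)
    (hΦ₁ : Φ₁ = A * Φ₀ + B * U₀) (hY₀ : Y₀ = H * Φ₀) (K : Matrix (Fin m) (Fin N) ℝ)
    (P : Matrix (Fin N) (Fin N) ℝ) :
    PolicyEvaluation Φ₀ Φ₁ U₀ Y₀ B Q R K P ↔
      (A - B * K)ᵀ * P + P * (A - B * K) + (Hᵀ * Q * H + Kᵀ * R * K) = 0 := by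
  have h1 : Φ₁ - B * (K * Φ₀ + U₀) = (A - B * K) * Φ₀ := by
    rw [hΦ₁, Matrix.mul_add, Matrix.sub_mul, Matrix.mul_assoc]
    abel
  have h2 : (Φ₁ - B * (K * Φ₀ + U₀))ᵀ * P * Φ₀ + Φ₀ᵀ * P * (Φ₁ - B * (K * Φ₀ + U₀))
      + Y₀ᵀ * Q * Y₀ + Φ₀ᵀ * Kᵀ * R * K * Φ₀ =
      Φ₀ᵀ * ((A - B * K)ᵀ * P + P * (A - B * K) + (Hᵀ * Q * H + Kᵀ * R * K)) * Φ₀ := by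
    rw [h1, hY₀]
    simp only [Matrix.transpose_mul, Matrix.mul_add, Matrix.add_mul, Matrix.mul_assoc, add_assoc]
  rw [PolicyEvaluation, h2]
  constructor
  · intro h
    -- A right inverse of `Φ₀` cancels the data on both sides.
    obtain ⟨Z, hZ⟩ := exists_right_inverse_of_rank hrank
    have h3 := congrArg (fun X => Zᵀ * X * Z) h
    have hZ' : Zᵀ * Φ₀ᵀ = 1 := by rw [← Matrix.transpose_mul, hZ, Matrix.transpose_one]
    simp only [← Matrix.mul_assoc, hZ', Matrix.one_mul, Matrix.mul_zero, Matrix.zero_mul] at h3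
    simpa only [Matrix.mul_assoc, hZ, Matrix.mul_one] using h3
  · intro h
    rw [h, Matrix.mul_zero, Matrix.zero_mul]

theorem toRows₁_mul_transpose {ι κ₁ κ₂ : Type*} [Fintype ι] [DecidableEq κ₁] [DecidableEq κ₂]
    {F : Matrix ι (κ₁ ⊕ κ₂) ℝ} (hF : Fᵀ * F = 1) : Fᵀ.toRows₁ * Fᵀ.toRows₁ᵀ = 1 := by
  ext i j
  have := congrFun (congrFun hF (Sum.inl i)) (Sum.inl j)
  simpa [Matrix.mul_apply, Matrix.one_apply] using this

theorem mul_fromRows_zero {ι κ₁ κ₂ τ : Type*} [Fintype κ₁] [Fintype κ₂]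
    (F : Matrix ι (κ₁ ⊕ κ₂) ℝ) (Φ : Matrix κ₁ τ ℝ) :
    F * Matrix.fromRows Φ (0 : Matrix κ₂ τ ℝ) = Fᵀ.toRows₁ᵀ * Φ := by
  ext i k
  rw [Matrix.mul_apply, Fintype.sum_sum_type]
  simp [Matrix.mul_apply]

theorem sampleMatrix_mulVec {ι : Type*} (T : ℕ) (t Δt : ℝ) (f : ℝ → ι → ℝ) (c : Fin T → ℝ) :
    sampleMatrix T t Δt f *ᵥ c = ∑ k, c k • f (t + (k : ℕ) * Δt) := by
  ext i
  simp [sampleMatrix, Matrix.mulVec, dotProduct, mul_comm]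

/-- A full row rank factor with the dimension of an invariant subspace containing the data spans
that subspace. -/
theorem projection_eq_of_mem {ι : Type*} [Fintype ι] {N T : ℕ}
    {E₀ : Matrix ι (Fin T) ℝ} {F₁ : Matrix (Fin N) ι ℝ}
    {Φ₀ : Matrix (Fin N) (Fin T) ℝ} (hF₁ : F₁ * F₁ᵀ = 1) (hE₀ : E₀ = F₁ᵀ * Φ₀)
    (hrank : Φ₀.rank = N) {W : Submodule ℝ (ι → ℝ)} (hW : Module.finrank ℝ W ≤ N)
    (hE : ∀ c, E₀ *ᵥ c ∈ W) : (∀ v, F₁ᵀ *ᵥ v ∈ W) ∧ ∀ w ∈ W, F₁ᵀ *ᵥ (F₁ *ᵥ w) = w := by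
  obtain ⟨Z, hZ⟩ := exists_right_inverse_of_rank hrank
  have hmem : ∀ v, F₁ᵀ *ᵥ v ∈ W := by
    intro v
    have := hE (Z *ᵥ v)
    rwa [hE₀, Matrix.mulVec_mulVec, Matrix.mul_assoc, hZ, Matrix.mul_one] at this
  have hinj : Function.Injective F₁ᵀ.mulVecLin := by
    intro v w h
    have := congrArg (F₁ *ᵥ ·) h
    simpa only [Matrix.mulVecLin_apply, Matrix.mulVec_mulVec, hF₁, Matrix.one_mulVec] using this
  have hle : LinearMap.range F₁ᵀ.mulVecLin ≤ W := by
    rintro _ ⟨v, rfl⟩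
    exact hmem v
  -- The range has dimension exactly `N` by injectivity and lies in `W`, whose dimension is at most
  -- `N`.
  have heq : LinearMap.range F₁ᵀ.mulVecLin = W := by
    refine Submodule.eq_of_le_of_finrank_le hle ?_
    rw [LinearMap.finrank_range_of_inj hinj, Module.finrank_fintype_fun_eq_card, Fintype.card_fin]
    exact hW
  refine ⟨hmem, fun w hw => ?_⟩
  rw [← heq] at hw
  obtain ⟨v, rfl⟩ := hw
  rw [Matrix.mulVecLin_apply, Matrix.mulVec_mulVec _ F₁, hF₁, Matrix.one_mulVec]

end Data

/-! ### The plant and the filter along the experiment -/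

section Experiment

variable {n m p : ℕ} {A : Matrix (Fin n) (Fin n) ℝ} {B : Matrix (Fin n) (Fin m) ℝ}
  {C : Matrix (Fin p) (Fin n) ℝ} {L : Matrix (Fin n) (Fin p) ℝ} {Aε : Matrix (Fin n) (Fin n) ℝ}
  {ηε₀ : Fin n → ℝ} {u : ℝ → Fin m → ℝ} {x : ℝ → Fin n → ℝ} {y : ℝ → Fin p → ℝ}
  {η : ℝ → EtaIdx n m p → ℝ}

/-- The state is a linear function of the substitute state. -/
theorem state_eq_stateParam_mulVec (hAε : Aε.charpoly = (A - L * C).charpoly)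
    (hηε₀ : IsUnit (adjKrylov Aε ηε₀))
    (hx : ∀ s : ℝ, 0 ≤ s → HasDerivWithinAt x (A *ᵥ x s + B *ᵥ u s) (Set.Ici 0) s)
    (hy : ∀ s : ℝ, 0 ≤ s → y s = C *ᵥ x s)
    (hη : ∀ s : ℝ, 0 ≤ s → HasDerivWithinAt η
      (filterA m p (A - L * C).charpoly Aε *ᵥ η s +
        filterB n m p *ᵥ Sum.elim (Sum.elim (u s) (y s)) 0) (Set.Ici 0) s)
    (hη₀ : η 0 = Sum.elim (fun _ => 0) ηε₀) {s : ℝ} (hs : 0 ≤ s) :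
    x s = stateParam (A - L * C) B L Aε (x 0) ηε₀ *ᵥ η s := by
  rw [← sub_eq_zero]
  -- The observation error `x - S η` obeys `e' = (A - L C) e`, as `u` and `y` cancel; the choice of
  -- the last block of `S` makes `e 0 = 0`.
  refine linear_ode_eq_zero (A - L * C)
    (f := fun s => x s - stateParam (A - L * C) B L Aε (x 0) ηε₀ *ᵥ η s) ?_ ?_ hs
  · intro t ht
    have h := (hx t ht).sub (HasDerivWithinAt.matrix_mulVec
      (stateParam (A - L * C) B L Aε (x 0) ηε₀) (hη t ht))
    convert! h using 1
    rw [filterB_mulVec, Matrix.mulVec_add, Matrix.mulVec_add,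
      stateParam_mulVec_filterA _ _ _ _ hAε hηε₀, stateParam_mulVec_filterBu,
      stateParam_mulVec_filterBy, hy t ht, Matrix.mulVec_sub, Matrix.sub_mulVec _ _ (x t),
      Matrix.mulVec_mulVec _ L C]
    abel
  · rw [hη₀, stateParam_mulVec_initial _ _ _ _ hηε₀, sub_self]

theorem hasDerivWithinAt_substitute (hAε : Aε.charpoly = (A - L * C).charpoly)
    (hηε₀ : IsUnit (adjKrylov Aε ηε₀))
    (hx : ∀ s : ℝ, 0 ≤ s → HasDerivWithinAt x (A *ᵥ x s + B *ᵥ u s) (Set.Ici 0) s)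
    (hy : ∀ s : ℝ, 0 ≤ s → y s = C *ᵥ x s)
    (hη : ∀ s : ℝ, 0 ≤ s → HasDerivWithinAt η
      (filterA m p (A - L * C).charpoly Aε *ᵥ η s +
        filterB n m p *ᵥ Sum.elim (Sum.elim (u s) (y s)) 0) (Set.Ici 0) s)
    (hη₀ : η 0 = Sum.elim (fun _ => 0) ηε₀) {s : ℝ} (hs : 0 ≤ s) :
    HasDerivWithinAt η (substituteA A B C L Aε (x 0) ηε₀ *ᵥ η s + filterBu n m p *ᵥ u s)
      (Set.Ici 0) s := by
  convert! hη s hs using 1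
  rw [substituteA_mulVec, ← state_eq_stateParam_mulVec hAε hηε₀ hx hy hη hη₀ hs, ← hy s hs,
    filterB_mulVec]
  abel

end Experiment

end DataLQR

/-! ### The proposition -/

theorem mainTheorem1 {n m p T : ℕ}
    -- the plant `x' = A x + B u`, `y = C x` and the cost weights
    (A : Matrix (Fin n) (Fin n) ℝ) (B : Matrix (Fin n) (Fin m) ℝ)
    (C : Matrix (Fin p) (Fin n) ℝ)
    (Q : Matrix (Fin p) (Fin p) ℝ) (R : Matrix (Fin m) (Fin m) ℝ)
    (hC : C.rank = p) (hQ : Q.PosSemidef) (hR : R.PosDef)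
    (hAB : DataLQR.IsControllable A B) (hAC : DataLQR.IsObservable A C)
    (hAQ : DataLQR.IsObservable A (DataLQR.psdSqrt (Cᵀ * Q * C)))
    -- the filter design
    (L : Matrix (Fin n) (Fin p) ℝ) (hL : DataLQR.IsHurwitz (A - L * C))
    (Aε : Matrix (Fin n) (Fin n) ℝ) (hAε : Aε.charpoly = (A - L * C).charpoly)
    (ηε₀ : Fin n → ℝ) (hηε₀ : IsUnit (DataLQR.adjKrylov Aε ηε₀))
    -- the experiment: a persistently exciting input, the plant and the filter
    (u : ℝ → Fin m → ℝ) (x : ℝ → Fin n → ℝ) (y : ℝ → Fin p → ℝ)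
    (η : ℝ → DataLQR.EtaIdx n m p → ℝ)
    (I : Set ℝ) (hIo : IsOpen I) (hIc : I.OrdConnected) (hIs : I ⊆ Set.Ici 0)
    (hu : DataLQR.IsPersistentlyExciting (2 * n) I u)
    (hx : ∀ s : ℝ, 0 ≤ s → HasDerivWithinAt x (A *ᵥ x s + B *ᵥ u s) (Set.Ici 0) s)
    (hy : ∀ s : ℝ, 0 ≤ s → y s = C *ᵥ x s)
    (hη : ∀ s : ℝ, 0 ≤ s → HasDerivWithinAt η
      (DataLQR.filterA m p (A - L * C).charpoly Aε *ᵥ η s +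
        DataLQR.filterB n m p *ᵥ Sum.elim (Sum.elim (u s) (y s)) 0) (Set.Ici 0) s)
    (hη₀ : η 0 = Sum.elim (fun _ => 0) ηε₀)
    -- the data matrices
    (t Δt : ℝ) (ht : 0 ≤ t) (hΔt : 0 < Δt)
    (E₀ E₁ : Matrix (DataLQR.EtaIdx n m p) (Fin T) ℝ)
    (hE₀ : E₀ = DataLQR.sampleMatrix T t Δt η)
    (hE₁ : E₁ = DataLQR.sampleMatrix T t Δt (derivWithin η (Set.Ici 0)))
    (U₀ : Matrix (Fin m) (Fin T) ℝ) (hU₀ : U₀ = DataLQR.sampleMatrix T t Δt u)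
    (Y₀ : Matrix (Fin p) (Fin T) ℝ) (hY₀ : Y₀ = DataLQR.sampleMatrix T t Δt y)
    -- the projection `F₁` from the orthogonal factor `F` of `E₀`, and the full row rank data
    (F : Matrix (DataLQR.EtaIdx n m p) (Fin ((m + 2) * n) ⊕ Fin ((p - 1) * n)) ℝ)
    (hF : Fᵀ * F = 1) (hF' : F * Fᵀ = 1)
    (F₁ : Matrix (Fin ((m + 2) * n)) (DataLQR.EtaIdx n m p) ℝ) (hF₁ : F₁ = Fᵀ.toRows₁)
    (Φ₀ Φ₁ : Matrix (Fin ((m + 2) * n)) (Fin T) ℝ)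
    (hΦ₀ : Φ₀ = F₁ * E₀) (hΦ₁ : Φ₁ = F₁ * E₁)
    (hEF : E₀ = F * Matrix.fromRows Φ₀ 0)
    (hrank : Φ₀.rank = (m + 2) * n)
    -- the transformed LQR problem
    (S : Matrix (Fin n) (DataLQR.EtaIdx n m p) ℝ)
    (hS : S = DataLQR.stateParam (A - L * C) B L Aε (x 0) ηε₀)
    (AF Qφ : Matrix (Fin ((m + 2) * n)) (Fin ((m + 2) * n)) ℝ)
    (BF : Matrix (Fin ((m + 2) * n)) (Fin m) ℝ)
    (hAF : AF = F₁ * (DataLQR.filterA m p (A - L * C).charpoly Aε +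
      DataLQR.filterBy n m p * C * S) * F₁ᵀ)
    (hBF : BF = F₁ * DataLQR.filterBu n m p)
    (hQφ : Qφ = F₁ * Sᵀ * Cᵀ * Q * C * S * F₁ᵀ)
    -- the initial stabilizing gain
    (K₀ : Matrix (Fin m) (Fin ((m + 2) * n)) ℝ) (hK₀ : DataLQR.IsHurwitz (AF - BF * K₀)) :
    -- the algorithm can be run
    (∃ P K, DataLQR.IsPolicyIteration Φ₀ Φ₁ U₀ Y₀ BF Q R K₀ P K) ∧
    ∃ (Pstar : Matrix (Fin ((m + 2) * n)) (Fin ((m + 2) * n)) ℝ)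
      (Kstar : Matrix (Fin m) (Fin ((m + 2) * n)) ℝ),
      -- `(Pstar, Kstar)` is the optimal solution of the transformed LQR problem
      (∀ P', DataLQR.IsRiccatiSolution AF BF Qφ R P' ↔ P' = Pstar) ∧
      Kstar = R⁻¹ * BFᵀ * Pstar ∧
      DataLQR.IsHurwitz (AF - BF * Kstar) ∧
      (∀ K', DataLQR.IsOptimalGain AF BF Qφ R K' ↔ K' = Kstar) ∧
      (∀ φ₀, DataLQR.feedbackCost AF BF Qφ R φ₀ Kstar =
        ENNReal.ofReal (φ₀ ⬝ᵥ (Pstar *ᵥ φ₀))) ∧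
      -- every run is uniquely determined, stabilizing, monotone and convergent
      ∀ P K, DataLQR.IsPolicyIteration Φ₀ Φ₁ U₀ Y₀ BF Q R K₀ P K →
        (∀ i P', DataLQR.PolicyEvaluation Φ₀ Φ₁ U₀ Y₀ BF Q R (K i) P' → P' = P i) ∧
        (∀ i, DataLQR.IsHurwitz (AF - BF * K i)) ∧
        (∀ i, (P i).PosSemidef) ∧
        (∀ i, (P i - P (i + 1)).PosSemidef) ∧
        Filter.Tendsto P Filter.atTop (nhds Pstar) ∧
        Filter.Tendsto K Filter.atTop (nhds Kstar) := by
  classical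
  have hode : ∀ s : ℝ, 0 ≤ s → HasDerivWithinAt η
      (DataLQR.substituteA A B C L Aε (x 0) ηε₀ *ᵥ η s + DataLQR.filterBu n m p *ᵥ u s)
      (Set.Ici 0) s := fun s hs => DataLQR.hasDerivWithinAt_substitute hAε hηε₀ hx hy hη hη₀ hs
  have hSη : ∀ s : ℝ, 0 ≤ s → x s = S *ᵥ η s := fun s hs => by
    rw [hS]
    exact DataLQR.state_eq_stateParam_mulVec hAε hηε₀ hx hy hη hη₀ hs
  have htime : ∀ k : Fin T, 0 ≤ t + (k : ℕ) * Δt := fun k => by positivity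
  have hF₁F₁ : F₁ * F₁ᵀ = 1 := hF₁ ▸ DataLQR.toRows₁_mul_transpose hF
  have hE₀Φ₀ : E₀ = F₁ᵀ * Φ₀ := by
    rw [hF₁]
    exact hEF.trans (DataLQR.mul_fromRows_zero F Φ₀)
  -- `W` contains the whole trajectory, hence the columns of `E₀`; full row rank of `Φ₀` will
  -- identify it with the range of `F₁ᵀ`.
  set W := LinearMap.range (DataLQR.reachMap A B C (x 0) (DataLQR.adjKrylov Aε ηε₀)) with hW
  have hWinv : ∀ w ∈ W, DataLQR.substituteA A B C L Aε (x 0) ηε₀ *ᵥ w ∈ W := by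
    rintro _ ⟨z, rfl⟩
    exact ⟨_, (DataLQR.substituteA_mulVec_reachMap A B C (x 0) L hAε hηε₀ z).symm⟩
  have hηW : ∀ s : ℝ, 0 ≤ s → η s ∈ W := fun s hs =>
    DataLQR.mem_of_linear_ode _ W hWinv
      (fun s => DataLQR.filterBu_mulVec_mem_range A B C (x 0) _ (u s)) hode
      (hη₀ ▸ DataLQR.initial_mem_range A B C (x 0) Aε ηε₀) hs
  have hEW : ∀ c, E₀ *ᵥ c ∈ W := fun c => by
    rw [hE₀, DataLQR.sampleMatrix_mulVec]
    exact W.sum_mem fun k _ => W.smul_mem _ (hηW _ (htime k))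
  obtain ⟨hmem, hproj⟩ := DataLQR.projection_eq_of_mem hF₁F₁ hE₀Φ₀ hrank
    (DataLQR.finrank_range_reachMap_le A B C (x 0) (DataLQR.adjKrylov Aε ηε₀)) hEW
  have hAF' : AF = F₁ * DataLQR.substituteA A B C L Aε (x 0) ηε₀ * F₁ᵀ := by
    rw [hAF, hS]
    rfl
  have hE₁' : E₁ = DataLQR.substituteA A B C L Aε (x 0) ηε₀ * E₀ +
      DataLQR.filterBu n m p * U₀ := by
    rw [hE₁, hE₀, hU₀]
    ext i k
    have h := congrFun ((hode _ (htime k)).derivWithin (uniqueDiffOn_Ici 0 _ (htime k))) i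
    exact h
  have hY₀' : Y₀ = (C * S * F₁ᵀ) * Φ₀ := by
    rw [Matrix.mul_assoc _ F₁ᵀ, ← hE₀Φ₀, hE₀, hY₀]
    ext j k
    have h := congrFun (hy _ (htime k)) j
    rw [hSη _ (htime k), Matrix.mulVec_mulVec] at h
    exact h
  have hΦ₁' : Φ₁ = AF * Φ₀ + BF * U₀ := by
    rw [hΦ₁, hE₁', hE₀Φ₀, hAF', hBF]
    simp only [Matrix.mul_add, Matrix.mul_assoc]
  have hQφ' : Qφ = (C * S * F₁ᵀ)ᵀ * Q * (C * S * F₁ᵀ) := by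
    rw [hQφ]
    simp only [Matrix.transpose_mul, Matrix.transpose_transpose, Matrix.mul_assoc]
  have hQpsd : Qφ.PosSemidef := hQφ' ▸ DataLQR.posSemidef_transpose_mul_mul hQ _
  -- The projection `F₁ᵀ F₁` fixes `W`, and `W` is invariant, so `AF` is the restriction of the
  -- substitute dynamics.
  have hdet : DataLQR.IsDetectable AF Qφ := by
    rw [hAF', hQφ, hS]
    exact DataLQR.isDetectable_restriction hQ hAQ hL hAε hηε₀ hF₁F₁
      fun v => hproj _ (hWinv _ (hmem v))
  refine DataLQR.policyIteration_convergence hQpsd hR hdet (fun K P => ?_) hK₀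
  rw [hQφ']
  exact DataLQR.policyEvaluation_iff hrank hΦ₁' hY₀' K P
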